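/- Let $D\subset\mathbb C^n$ be a bounded logarithmically convex complete Reinhardt domain centered at the origin, and let $\tau(D)=\{(|z_1|,\dots,|z_n|) : z\in D\}$. Let $\mu:\tau(D)\to(0,\infty)$ be a measurable weight, bounded near the origin, such that $\int_D\mu(|z_1|,\dots,|z_n|)\,dv(z)<\infty$; the choice $\mu\equiv1$ gives the usual Bergman metric. Let $K_D$ be the reproducing kernel of the space of holomorphic functions $f$ on $D$ with $\int_D|f(z)|^2\mu(|z_1|,\dots,|z_n|)\,dv(z)<\infty$, and let $$h_D=\operatorname{Re}\sum_{k,l=1}^n\frac{\partial^2\log K_D(z,z)}{\partial z_k\,\partial\bar z_l}\,dz_k\otimes d\bar z_l .$$ Let $\widehat D=\{z\in D: z_k\neq0\text{ for all }k\}$, and let $\mathbb T^n$ act by $(t_1,\dots,t_n)\cdot z=(t_1z_1,\dots,t_nz_n)$. Then: (a) $\widehat D$ is open, $D\setminus\widehat D$ has Lebesgue measure zero, and $h_D$ is a smooth Riemannian metric on $D$. (b) The $\mathbb T^n$-orbits in $\widehat D$ are the leaves of a smooth foliation $\mathcal O$ of $\widehat D$ of codimension $n$. The transverse frames $\mathbb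 R^n\to T_z\widehat D/T_z\mathcal O$ that are isometric for the inner product induced by $h_D$ (through $(T_z\mathcal O)^{\perp}\cong T_z\widehat D/T_z\mathcal O$) form a smooth $O(n)$-reduction of the transverse frame bundle that is saturated with respect to the lifted foliation. In other words, this reduction is a transverse Riemannian structure and makes $\mathcal O$ a Riemannian foliation. (c) $h_D$ is bundle-like for $\mathcal O$: for any two smooth vector fields $X,Y$ on $\widehat D$ that are foliate (their brackets with fields tangent to the leaves are again tangent to the leaves) and perpendicular to the leaves, the function $h_D(X,Y)$ is constant along each leaf. Hence $h_D$ is a bundle-like metric compatible with the Riemannian foliation of (b). (d) The leaves are equidistant: if $L,L'$ are leaves and $p,p'\in L$, then $d(p,L')=d(p',L')$, both for the Riemannian distance $d$ of $(\widehat D,h_D)$ and for that of $(D,h_D)$. -/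

import Mathlib

open scoped ContDiff ENNReal ComplexConjugate

/-! ### Foliations of open subsets of a finite-dimensional real vector space -/

section Foliations

variable {E : Type*} [NormedAddCommGroup E] [NormedSpace ℝ E]

/-- A codimension `q` foliated chart of the open set `M`: a smooth submersion from an open
subset `domain` of `M` to an open subset `target` of `ℝ^q`. -/
structure FoliatedChart (M : Set E) (q : ℕ) where
  domain : Set E
  target : Set (EuclideanSpace ℝ (Fin q))
  toFun : E → EuclideanSpace ℝ (Fin q)
  isOpen_domain : IsOpen domain
  isOpen_target : IsOpen target
  domain_subset : domain ⊆ M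
  mapsTo : Set.MapsTo toFun domain target
  smooth : ContDiffOn ℝ ∞ toFun domain
  submersion : ∀ x ∈ domain, Function.Surjective (fderiv ℝ toFun x)

/-- The fibre through `x` of a foliated chart. -/
def FoliatedChart.fiber {M : Set E} {q : ℕ} (c : FoliatedChart M q) (x : E) : Set E :=
  {y | y ∈ c.domain ∧ c.toFun y = c.toFun x}

/-- The plaques of a foliated chart: the connected components of its fibres. -/
def FoliatedChart.IsPlaque {M : Set E} {q : ℕ} (c : FoliatedChart M q) (P : Set E) : Prop :=
  ∃ x ∈ c.domain, P = connectedComponentIn (c.fiber x) x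

/-- Two foliated charts are compatible if some diffeomorphism `ψ`, with inverse `ψ'`, from
`φ₁ (U₁ ∩ U₂)` to `φ₂ (U₁ ∩ U₂)` satisfies `φ₂ = ψ ∘ φ₁` on `U₁ ∩ U₂`. -/
def FoliatedChart.Compatible {M : Set E} {q : ℕ} (c₁ c₂ : FoliatedChart M q) : Prop :=
  ∃ ψ ψ' : EuclideanSpace ℝ (Fin q) → EuclideanSpace ℝ (Fin q),
    ContDiffOn ℝ ∞ ψ (c₁.toFun '' (c₁.domain ∩ c₂.domain)) ∧
    ContDiffOn ℝ ∞ ψ' (c₂.toFun '' (c₁.domain ∩ c₂.domain)) ∧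
    ∀ x ∈ c₁.domain ∩ c₂.domain, ψ (c₁.toFun x) = c₂.toFun x ∧ ψ' (c₂.toFun x) = c₁.toFun x

/-- A foliation of codimension `q` of `M`, given by a foliated atlas. -/
structure Foliation (M : Set E) (q : ℕ) where
  charts : Set (FoliatedChart M q)
  compatible : ∀ c₁ ∈ charts, ∀ c₂ ∈ charts, c₁.Compatible c₂
  cover : ⋃ c ∈ charts, c.domain = M

namespace Foliation

variable {M : Set E} {q : ℕ}

/-- The equivalence relation of a foliated atlas: being joined by a finite nonempty chain of
plaques in which consecutive plaques meet. -/
def Rel (F : Foliation M q) : E → E → Prop :=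
  Relation.TransGen fun x y => ∃ c ∈ F.charts, ∃ P, c.IsPlaque P ∧ x ∈ P ∧ y ∈ P

/-- The leaves: the classes in `M` of the equivalence relation of the atlas. -/
def leaves (F : Foliation M q) : Set (Set E) :=
  {L | ∃ x ∈ M, L = {y | F.Rel x y}}

/-- The tangent space at `x` of the leaf through `x`: the kernel of the differential of any
chart around `x` (by compatibility this kernel is the same for all charts around `x`, so it
equals the intersection taken here). -/
noncomputable def tangent (F : Foliation M q) (x : E) : Submodule ℝ E :=
  ⨅ c ∈ F.charts, ⨅ _ : x ∈ c.domain, (fderiv ℝ c.toFun x).toLinearMap.ker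

theorem tangent_le_ker (F : Foliation M q) {c : FoliatedChart M q} (hc : c ∈ F.charts) {x : E}
    (hx : x ∈ c.domain) : F.tangent x ≤ (fderiv ℝ c.toFun x).toLinearMap.ker :=
  iInf_le_of_le c (iInf_le_of_le hc (iInf_le_of_le hx le_rfl))

/-- A point of the transverse frame bundle `L_T(F)`: a point `pt` of `M` with a linear
isomorphism from `ℝ^q` to the transverse space `T_x M / T_x F` at `x = pt`. -/
@[ext]
structure TransverseFrame (F : Foliation M q) where
  pt : E
  frame : EuclideanSpace ℝ (Fin q) ≃ₗ[ℝ] (E ⧸ F.tangent pt)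
  mem : pt ∈ M

variable {F : Foliation M q}

/-- The coframe `T_x M → T_x M / T_x F → ℝ^q` of a transverse frame. -/
noncomputable def TransverseFrame.coframe [FiniteDimensional ℝ E] (f : F.TransverseFrame) :
    E →L[ℝ] EuclideanSpace ℝ (Fin q) :=
  LinearMap.toContinuousLinearMap (f.frame.symm.toLinearMap ∘ₗ (F.tangent f.pt).mkQ)

/-- The topology of the transverse frame bundle; the bundle embeds in
`E × Hom(E, ℝ^q)` by sending a frame to its base point and its coframe. -/
noncomputable instance instTopologicalSpaceTransverseFrame [FiniteDimensional ℝ E] : TopologicalSpace F.TransverseFrame :=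
  TopologicalSpace.induced (fun f => (f.pt, f.coframe)) inferInstance

/-- The right action of `GL_q(ℝ)` on the transverse frame bundle. -/
noncomputable def TransverseFrame.act (f : F.TransverseFrame)
    (g : EuclideanSpace ℝ (Fin q) ≃ₗ[ℝ] EuclideanSpace ℝ (Fin q)) : F.TransverseFrame :=
  ⟨f.pt, g.trans f.frame, f.mem⟩

/-- The lifted chart `A ↦ (φ x, (dφ_x)^t ∘ A)` with values in the frame bundle of `ℝ^q`, where
`(dφ_x)^t : T_x M / T_x F → ℝ^q` is induced by `dφ_x`. -/
noncomputable def liftedChart {c : FoliatedChart M q} (hc : c ∈ F.charts) (f : F.TransverseFrame)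
    (hf : f.pt ∈ c.domain) :
    EuclideanSpace ℝ (Fin q) × (EuclideanSpace ℝ (Fin q) →ₗ[ℝ] EuclideanSpace ℝ (Fin q)) :=
  (c.toFun f.pt,
    (F.tangent f.pt).liftQ (fderiv ℝ c.toFun f.pt).toLinearMap (F.tangent_le_ker hc hf) ∘ₗ
      f.frame.toLinearMap)

/-- The fibre through `f` of a lifted chart. -/
def liftedFiber {c : FoliatedChart M q} (hc : c ∈ F.charts) (f : F.TransverseFrame)
    (hf : f.pt ∈ c.domain) : Set F.TransverseFrame :=
  {g | ∃ hg : g.pt ∈ c.domain, liftedChart hc g hg = liftedChart hc f hf}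

/-- The plaques of the lifted foliation. -/
def IsLiftedPlaque [FiniteDimensional ℝ E] (F : Foliation M q) (P : Set F.TransverseFrame) :
    Prop :=
  ∃ (c : FoliatedChart M q) (hc : c ∈ F.charts) (f : F.TransverseFrame) (hf : f.pt ∈ c.domain),
    P = connectedComponentIn (liftedFiber hc f hf) f

/-- The equivalence relation on the transverse frame bundle whose classes are the leaves of
the lifted foliation. -/
def LiftedRel [FiniteDimensional ℝ E] (F : Foliation M q) :
    F.TransverseFrame → F.TransverseFrame → Prop :=
  Relation.TransGen fun f g => ∃ P, F.IsLiftedPlaque P ∧ f ∈ P ∧ g ∈ P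

/-- `Q` is saturated: it contains every leaf of the lifted foliation that it meets. -/
def IsSaturated [FiniteDimensional ℝ E] (F : Foliation M q) (Q : Set F.TransverseFrame) : Prop :=
  ∀ f ∈ Q, ∀ g, F.LiftedRel f g → g ∈ Q

/-- `Q` is a (smooth) reduction of the transverse frame bundle to the group `H`: it is
`H`-invariant, `H` is transitive on the part of `Q` over each point, and near every point of
`M` the bundle has a smooth section with values in `Q`. -/
structure IsReduction [FiniteDimensional ℝ E] (F : Foliation M q)
    (H : Subgroup (EuclideanSpace ℝ (Fin q) ≃ₗ[ℝ] EuclideanSpace ℝ (Fin q)))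
    (Q : Set F.TransverseFrame) : Prop where
  invariant : ∀ f ∈ Q, ∀ g ∈ H, f.act g ∈ Q
  transitive : ∀ f ∈ Q, ∀ f' ∈ Q, f.pt = f'.pt → ∃ g ∈ H, f' = f.act g
  section_near : ∀ x ∈ M, ∃ U : Set E, IsOpen U ∧ x ∈ U ∧ ∃ s : E → F.TransverseFrame,
    (∀ y ∈ U, (s y).pt = y ∧ s y ∈ Q) ∧ ContDiffOn ℝ ∞ (fun y => (s y).coframe) U

end Foliation

/-- The orthogonal group `O(q)` as a subgroup of `GL_q(ℝ)`. -/
def orthogonalSubgroup (q : ℕ) :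
    Subgroup (EuclideanSpace ℝ (Fin q) ≃ₗ[ℝ] EuclideanSpace ℝ (Fin q)) where
  carrier := {g | ∀ v, ‖g v‖ = ‖v‖}
  mul_mem' := by
    intro a b ha hb v
    exact (ha (b v)).trans (hb v)
  one_mem' := fun _ => rfl
  inv_mem' := by
    intro a ha v
    have h := ha (a.symm v)
    rw [LinearEquiv.apply_symm_apply] at h
    exact h.symm

/-- A transverse Riemannian structure: a saturated `O(q)`-reduction of the transverse frame
bundle. -/
structure Foliation.IsTransverseRiemannianStructure [FiniteDimensional ℝ E] {M : Set E} {q : ℕ}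
    (F : Foliation M q) (Q : Set F.TransverseFrame) : Prop where
  isReduction : F.IsReduction (orthogonalSubgroup q) Q
  isSaturated : F.IsSaturated Q

/-- A Riemannian foliation: a foliation endowed with a transverse Riemannian structure. -/
structure RiemannianFoliation [FiniteDimensional ℝ E] (M : Set E) (q : ℕ) extends
    Foliation M q where
  structureBundle : Set toFoliation.TransverseFrame
  isTransverseRiemannian : toFoliation.IsTransverseRiemannianStructure structureBundle

/-- `h` is a smooth Riemannian metric on the open set `M`. -/
structure IsRiemannianMetricOn (M : Set E) (h : E → LinearMap.BilinForm ℝ E) : Prop where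
  smooth : ∀ u v, ContDiffOn ℝ ∞ (fun x => h x u v) M
  symm : ∀ x ∈ M, ∀ u v, h x u v = h x v u
  pos : ∀ x ∈ M, ∀ u, u ≠ 0 → 0 < h x u u

namespace Foliation

variable {M : Set E} {q : ℕ}

/-- `v` is `h`-perpendicular at `x` to the leaf through `x`. -/
def Perp (F : Foliation M q) (h : E → LinearMap.BilinForm ℝ E) (x v : E) : Prop :=
  ∀ w ∈ F.tangent x, h x v w = 0

/-- `X` is a smooth vector field on `M` tangent to the leaves. -/
def IsTangentField (F : Foliation M q) (X : E → E) : Prop :=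
  ContDiffOn ℝ ∞ X M ∧ ∀ x ∈ M, X x ∈ F.tangent x

/-- `X` is a foliate smooth vector field on `M`: its bracket with every field tangent to the
leaves is tangent to the leaves. -/
def IsFoliate (F : Foliation M q) (X : E → E) : Prop :=
  ContDiffOn ℝ ∞ X M ∧
    ∀ Y, F.IsTangentField Y → ∀ x ∈ M, VectorField.lieBracket ℝ X Y x ∈ F.tangent x

/-- `h` is bundle-like: `h(X, Y)` is constant along the leaves for all foliate fields `X`, `Y`
perpendicular to the leaves. -/
def IsBundleLike (F : Foliation M q) (h : E → LinearMap.BilinForm ℝ E) : Prop :=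
  ∀ X Y, F.IsFoliate X → F.IsFoliate Y →
    (∀ x ∈ M, F.Perp h x (X x)) → (∀ x ∈ M, F.Perp h x (Y x)) →
    ∀ L ∈ F.leaves, ∀ x ∈ L, ∀ y ∈ L, h x (X x) (Y x) = h y (X y) (Y y)

/-- `O_T(M, h)`: the transverse frames that are isometries from Euclidean `ℝ^q` to
`T_x M / T_x F`, whose inner product is that of `h` on the orthogonal complement of `T_x F`. -/
def orthonormalFrames (F : Foliation M q) (h : E → LinearMap.BilinForm ℝ E) :
    Set F.TransverseFrame :=
  {f | ∀ v w, F.Perp h f.pt v → F.Perp h f.pt w →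
    inner ℝ (f.frame.symm ((F.tangent f.pt).mkQ v)) (f.frame.symm ((F.tangent f.pt).mkQ w))
      = h f.pt v w}

end Foliation

/-- `h` is a bundle-like Riemannian metric on `M` compatible with the Riemannian foliation. -/
structure RiemannianFoliation.IsCompatibleBundleLike [FiniteDimensional ℝ E] {M : Set E} {q : ℕ}
    (F : RiemannianFoliation M q) (h : E → LinearMap.BilinForm ℝ E) : Prop where
  isRiemannianMetric : IsRiemannianMetricOn M h
  isBundleLike : F.toFoliation.IsBundleLike h
  compatible : F.structureBundle = F.toFoliation.orthonormalFrames h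

/-- The `h`-length of a curve parametrized by `[0, 1]`. -/
noncomputable def curveLength (h : E → LinearMap.BilinForm ℝ E) (γ : ℝ → E) : ℝ≥0∞ :=
  ∫⁻ t in Set.Icc (0 : ℝ) 1, ENNReal.ofReal
    (Real.sqrt (h (γ t) (derivWithin γ (Set.Icc 0 1) t) (derivWithin γ (Set.Icc 0 1) t)))

/-- The Riemannian distance of `(M, h)`: the infimum of the lengths of the `C¹` curves in `M`
from `x` to `y`. -/
noncomputable def riemannianDist (M : Set E) (h : E → LinearMap.BilinForm ℝ E) (x y : E) : ℝ≥0∞ :=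
  ⨅ (γ : ℝ → E) (_ : ContDiffOn ℝ 1 γ (Set.Icc 0 1)) (_ : Set.MapsTo γ (Set.Icc 0 1) M)
    (_ : γ 0 = x) (_ : γ 1 = y), curveLength h γ

/-- The members of the family `𝓛` of subsets of `M` are equidistant in `(M, h)`: the distance
from a point of `L` to `L'` is the same for all points of `L`. -/
def Equidistant (M : Set E) (h : E → LinearMap.BilinForm ℝ E) (𝓛 : Set (Set E)) : Prop :=
  ∀ L ∈ 𝓛, ∀ L' ∈ 𝓛, ∀ p ∈ L, ∀ p' ∈ L,
    ⨅ y ∈ L', riemannianDist M h p y = ⨅ y ∈ L', riemannianDist M h p' y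

end Foliations

/-! ### Reinhardt domains and the Bergman metric -/

section Reinhardt

variable {n : ℕ}

/-- The vector of moduli `(|z_1|, …, |z_n|)`. -/
noncomputable def moduli (z : Fin n → ℂ) : Fin n → ℝ := fun k => ‖z k‖

/-- The points of `D` with no vanishing coordinate. -/
def puncturedPart (D : Set (Fin n → ℂ)) : Set (Fin n → ℂ) := {z | z ∈ D ∧ ∀ k, z k ≠ 0}

/-- `D` is a bounded logarithmically convex complete Reinhardt domain centered at the origin. -/
structure IsBoundedLogConvexCompleteReinhardt (D : Set (Fin n → ℂ)) : Prop where
  isOpen : IsOpen D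
  isConnected : IsConnected D
  isBounded : Bornology.IsBounded D
  complete : ∀ z ∈ D, ∀ w : Fin n → ℂ, (∀ k, ‖w k‖ ≤ ‖z k‖) → w ∈ D
  logConvex : Convex ℝ ((fun (z : Fin n → ℂ) (k : Fin n) => Real.log ‖z k‖) '' puncturedPart D)

/-- `μ` is an admissible weight on the base `τ(D) = {(|z_1|, …, |z_n|) : z ∈ D}` of `D`. -/
structure IsReinhardtWeight (D : Set (Fin n → ℂ)) (μ : (Fin n → ℝ) → ℝ) : Prop where
  measurable : Measurable fun r : moduli '' D => μ r
  pos : ∀ r ∈ moduli '' D, 0 < μ r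
  integrable : MeasureTheory.IntegrableOn (fun z => μ (moduli z)) D
  bounded_near_zero : ∃ ε > 0, ∃ C, ∀ r ∈ moduli '' D, ‖r‖ < ε → μ r ≤ C

/-- Membership in the weighted Bergman space: `f` is holomorphic on `D` and
`∫_D |f(z)|² μ(|z|) dv(z) < ∞`. -/
def MemBergmanSpace (D : Set (Fin n → ℂ)) (μ : (Fin n → ℝ) → ℝ) (f : (Fin n → ℂ) → ℂ) : Prop :=
  DifferentiableOn ℂ f D ∧
    MeasureTheory.IntegrableOn (fun z => ‖f z‖ ^ 2 * μ (moduli z)) D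

/-- `k` belongs to the weighted Bergman space and represents evaluation at `ζ` on it:
`f(ζ) = ⟨f, k⟩`. -/
def IsReproducingAt (D : Set (Fin n → ℂ)) (μ : (Fin n → ℝ) → ℝ) (ζ : Fin n → ℂ)
    (k : (Fin n → ℂ) → ℂ) : Prop :=
  MemBergmanSpace D μ k ∧
    ∀ f, MemBergmanSpace D μ f → f ζ = ∫ z in D, f z * conj (k z) * (μ (moduli z) : ℂ)

open Classical in
/-- The (weighted) Bergman kernel `K_D(z, ζ)`: the function `K_D(·, ζ)` is the element of the
Bergman space, unique on `D`, that represents evaluation at `ζ`. For `μ = 1` it is the usual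
Bergman kernel of `D`. -/
noncomputable def bergmanKernel (D : Set (Fin n → ℂ)) (μ : (Fin n → ℝ) → ℝ)
    (z ζ : Fin n → ℂ) : ℂ :=
  if h : ∃ k, IsReproducingAt D μ ζ k then h.choose z else 0

/-- `∂f/∂z_k = (∂f/∂x_k - i ∂f/∂y_k) / 2`. -/
noncomputable def dz (k : Fin n) (f : (Fin n → ℂ) → ℂ) (z : Fin n → ℂ) : ℂ :=
  (fderiv ℝ f z (Pi.single k 1) - Complex.I * fderiv ℝ f z (Pi.single k Complex.I)) / 2

/-- `∂f/∂z̄_k = (∂f/∂x_k + i ∂f/∂y_k) / 2`. -/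
noncomputable def dzbar (k : Fin n) (f : (Fin n → ℂ) → ℂ) (z : Fin n → ℂ) : ℂ :=
  (fderiv ℝ f z (Pi.single k 1) + Complex.I * fderiv ℝ f z (Pi.single k Complex.I)) / 2

/-- The coefficient `∂² log K_D(z, z) / ∂z_k ∂z̄_l` of the Bergman metric. -/
noncomputable def bergmanCoeff (D : Set (Fin n → ℂ)) (μ : (Fin n → ℝ) → ℝ) (k l : Fin n)
    (z : Fin n → ℂ) : ℂ :=
  dz k (dzbar l fun w => (Real.log (bergmanKernel D μ w w).re : ℂ)) z

/-- The Riemannian metric `h_D = Re ds²_D` of the Bergman metric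
`ds²_D = ∑_{k,l} ∂² log K_D(z, z) / ∂z_k ∂z̄_l dz_k ⊗ dz̄_l`. -/
noncomputable def bergmanMetric (D : Set (Fin n → ℂ)) (μ : (Fin n → ℝ) → ℝ) (z : Fin n → ℂ) :
    LinearMap.BilinForm ℝ (Fin n → ℂ) :=
  LinearMap.mk₂ ℝ (fun u v => (∑ k, ∑ l, bergmanCoeff D μ k l z * u k * conj (v l)).re)
    (fun u u' v => by simp [mul_add, add_mul, Finset.sum_add_distrib])
    (fun a u v => by
      simp only [Pi.smul_apply, Complex.real_smul, smul_eq_mul]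
      rw [← Complex.re_ofReal_mul, Finset.mul_sum]
      refine congrArg Complex.re (Finset.sum_congr rfl fun k _ => ?_)
      rw [Finset.mul_sum]
      exact Finset.sum_congr rfl fun l _ => by ring)
    (fun u v v' => by simp [mul_add, Finset.sum_add_distrib])
    (fun a u v => by
      simp only [Pi.smul_apply, Complex.real_smul, smul_eq_mul, map_mul, Complex.conj_ofReal]
      rw [← Complex.re_ofReal_mul, Finset.mul_sum]
      refine congrArg Complex.re (Finset.sum_congr rfl fun k _ => ?_)
      rw [Finset.mul_sum]
      exact Finset.sum_congr rfl fun l _ => by ring)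

/-- The orbit of `z` under the torus `𝕋^n` acting by `t · z = (t_1 z_1, …, t_n z_n)`. -/
def torusOrbit (z : Fin n → ℂ) : Set (Fin n → ℂ) :=
  Set.range fun (t : Fin n → Circle) (k : Fin n) => (t k : ℂ) * z k

end Reinhardt

/-!
The Bergman metric is invariant under every symmetry of the Bergman kernel on the diagonal, and
`K_D(z, z)` depends only on the moduli `|z_k|`. The torus therefore acts by isometries, and a torus
acting freely by isometries on `D̂` has orbits that form a Riemannian foliation with equidistant
leaves, for which the metric is bundle-like.

*Existence and smoothness of the kernel.* No power series are needed. The Cauchy formula on the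
polydisc bounded by the torus through `z`, averaged over all `z` in a torus invariant set
`S = {z ∈ D : |z_k| > ρ_k}` against the weight, represents evaluation at `ζ` by the explicit element
`ν(S)⁻¹ 1_S ∏_k (1 - ζ_k / z_k)⁻¹` of `L²(D, μ dv)`, which is holomorphic in `ζ`
(`exists_contDiffOn_representing`). Only positivity and integrability of the weight enter. The same
representation shows that the conjugates of the holomorphic functions form a closed subspace of `L²`
(`isClosed_conjBergmanSpace`); projecting to it gives a holomorphic map `Φ` into a Hilbert space
with `K_D(ζ, ζ) = ‖Φ(ζ)‖²` (`exists_bergmanKernel_eq_norm_sq`).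

*The metric.* With `g = log K_D(z, z)`, the metric is `h(u, v) = (D²g(u, v) + D²g(iu, iv)) / 4`
(`bergmanMetric_eq_leviForm`). For `g = log ‖Φ‖²` this is
`(‖Φ‖² ‖∂_uΦ‖² - |⟨Φ, ∂_uΦ⟩|²) / ‖Φ‖⁴` on the diagonal, so positivity is the strict Cauchy-Schwarz
inequality, tested on the functions `1` and `z_k` of the Bergman space
(`bergmanPotential_smooth_and_pos`). The formula also shows that real linear maps that commute or
anticommute with `i` and preserve moduli are isometries (`bergmanMetric_comp`). This applies to the
torus, and to the reflection `w_k ↦ (z_k / z̄_k) w̄_k` fixing `z`, whence the vectors perpendicular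
to the orbit of `z` are exactly the radial ones `(a_k z_k)` with `a_k` real
(`perp_torusFoliation_iff`).

*The foliation.* The single chart `z ↦ (log |z_k|)_k` has the torus orbits as fibres. Orthonormal
transverse frames are obtained from a smooth Cholesky factorization of the Gram matrix of the radial
vectors, and are preserved along lifted leaves because the torus acts by isometries. A perpendicular
foliate field is `(a_k z_k)` with `a_k` torus invariant (`logModuliDeriv_foliate`), so `h(X, Y)` is
constant along the leaves. Finally, torus elements map curves to curves of the same length, which
gives equidistance.
-/

/-! ### The Cauchy integral formula on polydiscs -/

section Torus

open MeasureTheory Complex Topology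

variable {n : ℕ}

/-- The action of the angle vector `θ` on `ℂⁿ`: rotation of the `k`-th coordinate by `θ k`. -/
noncomputable def torusAct (θ : Fin n → ℝ) (z : Fin n → ℂ) : Fin n → ℂ :=
  fun k => exp (θ k * I) * z k

@[simp]
theorem norm_torusAct (θ : Fin n → ℝ) (z : Fin n → ℂ) (k : Fin n) :
    ‖torusAct θ z k‖ = ‖z k‖ := by
  simp [torusAct, norm_exp_ofReal_mul_I]

@[simp]
theorem moduli_torusAct (θ : Fin n → ℝ) (z : Fin n → ℂ) : moduli (torusAct θ z) = moduli z := by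
  ext k; simp [moduli]

theorem continuous_torusAct : Continuous fun p : (Fin n → ℝ) × (Fin n → ℂ) => torusAct p.1 p.2 := by
  unfold torusAct; fun_prop

@[simp]
theorem torusAct_zero (z : Fin n → ℂ) : torusAct 0 z = z := by
  ext k
  simp [torusAct]

@[simp]
theorem torusAct_neg_torusAct (θ : Fin n → ℝ) (z : Fin n → ℂ) :
    torusAct (-θ) (torusAct θ z) = z := by
  ext k
  simp [torusAct, ← mul_assoc, ← exp_add]

@[simp]
theorem torusAct_torusAct_neg (θ : Fin n → ℝ) (z : Fin n → ℂ) :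
    torusAct θ (torusAct (-θ) z) = z := by
  ext k
  simp [torusAct, ← mul_assoc, ← exp_add]

/-- The one-variable formula is applied to one coordinate after the other; each step only restricts
`f` to slices, so no holomorphic dependence of an integral on parameters is needed. -/
theorem torusIntegral_prod_sub_inv_mul {n : ℕ} (R : Fin n → ℝ) (f : (Fin n → ℂ) → ℂ)
    (hf : ∀ w : Fin n → ℂ, (∀ k, ‖w k‖ ≤ R k) → DifferentiableAt ℂ f w) (ζ : Fin n → ℂ)
    (hζ : ∀ k, ‖ζ k‖ < R k) :
    torusIntegral (fun w => (∏ k, (w k - ζ k)⁻¹) * f w) 0 R = (2 * Real.pi * I) ^ n * f ζ := by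
  induction n with
  | zero => simp [torusIntegral_dim0, Subsingleton.elim ζ 0]
  | succ n ih =>
    have hR : ∀ k, 0 < R k := fun k => (norm_nonneg _).trans_lt (hζ k)
    have hnorm : ∀ (θ : Fin (n + 1) → ℝ) k, ‖torusMap 0 R θ k‖ = R k := fun θ k => by
      simp [torusMap, abs_of_pos (hR k)]
    have hcont : Continuous fun θ => (∏ k, (torusMap 0 R θ k - ζ k)⁻¹) * f (torusMap 0 R θ) := by
      have hmap : Continuous (torusMap 0 R) := by unfold torusMap; fun_prop
      refine Continuous.mul (continuous_finsetProd _ fun k _ => Continuous.inv₀ (by fun_prop) ?_) ?_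
      · intro θ h
        have := hnorm θ k
        rw [sub_eq_zero.1 h] at this
        exact (hζ k).ne this
      · exact continuous_iff_continuousAt.2 fun θ =>
          ContinuousAt.comp (hf _ fun k => (hnorm θ k).le).continuousAt hmap.continuousAt
    rw [torusIntegral_succ (Continuous.integrableOn_Icc hcont)]
    have hin : ∀ x ∈ Metric.sphere (0 : ℂ) (R 0),
        torusIntegral (fun y : Fin n → ℂ =>
          (∏ k, ((Fin.cons x y : Fin (n + 1) → ℂ) k - ζ k)⁻¹) * f (Fin.cons x y))
          ((0 : Fin (n + 1) → ℂ) ∘ Fin.succ) (R ∘ Fin.succ)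
          = (x - ζ 0)⁻¹ • ((2 * Real.pi * I) ^ n * f (Fin.cons x fun k => ζ k.succ)) := by
      intro x hx
      have hx' : ‖x‖ = R 0 := by simpa using hx
      rw [smul_eq_mul, ← ih (fun k => R k.succ) (fun y => f (Fin.cons x y)) ?_ _ fun k => hζ k.succ,
        ← torusIntegral_const_mul]
      · congr 1
        ext y
        simp [Fin.prod_univ_succ, mul_assoc, mul_left_comm]
      · intro w hw
        refine DifferentiableAt.comp w (hf _ ?_) ?_
        · exact Fin.cases (by simp [hx']) (by simpa using hw)
        · refine differentiableAt_pi.2 (Fin.cases (by simp) fun k => ?_)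
          simpa using differentiableAt_apply k w
    rw [Pi.zero_apply, circleIntegral.integral_congr (hR 0).le hin]
    have key := DifferentiableOn.circleIntegral_sub_inv_smul (R := R 0) (c := 0) (w := ζ 0)
      (f := fun x => (2 * Real.pi * I) ^ n * f (Fin.cons x fun k => ζ k.succ)) ?_
      (by simpa using hζ 0)
    · refine key.trans ?_
      have : (Fin.cons (ζ 0) fun k : Fin n => ζ k.succ : Fin (n + 1) → ℂ) = ζ :=
        Fin.cons_self_tail ζ
      rw [this, smul_eq_mul]
      ring
    · intro x hx
      refine (DifferentiableAt.const_mul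
        (DifferentiableAt.comp x (hf _ ?_) ?_) _).differentiableWithinAt
      · refine Fin.cases (by simpa using hx) fun k => by simpa using (hζ k.succ).le
      · refine differentiableAt_pi.2 (Fin.cases (by simp) fun k => by simp)

/-- The Cauchy integral formula on the polydisc whose distinguished boundary is the torus
through `z`. -/
theorem setIntegral_torusAct_mul_prod (f : (Fin n → ℂ) → ℂ) (z ζ : Fin n → ℂ)
    (hf : ∀ w : Fin n → ℂ, (∀ k, ‖w k‖ ≤ ‖z k‖) → DifferentiableAt ℂ f w)
    (hζ : ∀ k, ‖ζ k‖ < ‖z k‖) :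
    ∫ θ in Set.Icc (0 : Fin n → ℝ) fun _ => 2 * Real.pi,
      f (torusAct θ z) * ∏ k, (1 - ζ k / torusAct θ z k)⁻¹ = (2 * Real.pi) ^ n * f ζ := by
  have hz : ∀ k, z k ≠ 0 := fun k h => by
    have := hζ k
    rw [h, norm_zero] at this
    exact absurd this (norm_nonneg _).not_gt
  have hz' : ∀ k, (‖z k‖ : ℂ) ≠ 0 := fun k => by simpa using hz k
  -- The formula for the torus with base point `‖z‖`, pulled back by the rotation taking it to `z`.
  have key := torusIntegral_prod_sub_inv_mul (fun k => ‖z k‖)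
    (fun w => f fun k => z k / ‖z k‖ * w k) ?_ (fun k => ‖z k‖ / z k * ζ k) ?_
  · have h1 : (fun k => z k / ‖z k‖ * (‖z k‖ / z k * ζ k)) = ζ := by
      ext k
      field_simp [hz k, hz' k]
    rw [h1, torusIntegral] at key
    have hI : (I : ℂ) ^ n ≠ 0 := pow_ne_zero _ I_ne_zero
    rw [← mul_right_inj' hI, ← integral_const_mul]
    rw [mul_pow _ I, mul_comm _ (I ^ n), mul_assoc] at key
    rw [← key]
    refine integral_congr_ae (Filter.Eventually.of_forall fun θ => ?_)
    have h2 : (fun k => z k / ‖z k‖ * torusMap 0 (fun k => ‖z k‖) θ k) = torusAct θ z := by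
      ext k
      simp only [torusMap, torusAct, Pi.zero_apply, zero_add]
      field_simp [hz k, hz' k]
    have h3 : ∀ k, (‖z k‖ : ℂ) * exp (θ k * I) * I
        * (torusMap 0 (fun k => ‖z k‖) θ k - ‖z k‖ / z k * ζ k)⁻¹
        = I * (1 - ζ k / torusAct θ z k)⁻¹ := fun k => by
      simp only [torusMap, torusAct, Pi.zero_apply, zero_add]
      have he : exp (θ k * I) ≠ 0 := exp_ne_zero _
      have : (‖z k‖ : ℂ) * exp (θ k * I) - ‖z k‖ / z k * ζ k
          = ‖z k‖ * exp (θ k * I) * (1 - ζ k / (exp (θ k * I) * z k)) := by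
        field_simp [hz k, hz' k]
      rw [this, mul_inv]
      field_simp [hz k, hz' k]
    simp only [smul_eq_mul]
    rw [h2, ← mul_assoc (∏ i, _ : ℂ), ← Finset.prod_mul_distrib,
      Finset.prod_congr rfl fun k _ => h3 k,
      Finset.prod_mul_distrib]
    simp
    ring
  · intro w hw
    refine DifferentiableAt.comp (g := f) w (hf _ fun k => ?_) (by fun_prop)
    simpa [hz k] using hw k
  · intro k
    simpa [hz k] using hζ k

theorem measurePreserving_torusAct (θ : Fin n → ℝ) :
    MeasurePreserving (torusAct θ) (volume : Measure (Fin n → ℂ)) volume := by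
  refine volume_preserving_pi (f := fun k (x : ℂ) => exp (θ k * I) * x) fun k => ?_
  exact (rotation (Circle.exp (θ k))).measurePreserving

/-- The action of an angle vector as a homeomorphism. -/
noncomputable def torusHomeomorph (θ : Fin n → ℝ) : (Fin n → ℂ) ≃ₜ (Fin n → ℂ) where
  toFun := torusAct θ
  invFun := torusAct (-θ)
  left_inv := torusAct_neg_torusAct θ
  right_inv := torusAct_torusAct_neg θ
  continuous_toFun := continuous_torusAct.comp (by fun_prop : Continuous fun z => (θ, z))
  continuous_invFun := continuous_torusAct.comp (by fun_prop : Continuous fun z => (-θ, z))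

theorem measurableEmbedding_torusAct (θ : Fin n → ℝ) :
    MeasurableEmbedding (torusAct θ : (Fin n → ℂ) → _) :=
  (torusHomeomorph θ).measurableEmbedding

/-- The torus acts transitively on the points with given moduli, also where coordinates vanish. -/
theorem torus_transitive {z w : Fin n → ℂ} (h : moduli w = moduli z) :
    ∃ θ : Fin n → ℝ, w = torusAct θ z := by
  refine ⟨fun k => arg (w k / z k), funext fun k => ?_⟩
  have hk : ‖w k‖ = ‖z k‖ := congrFun h k
  by_cases hz : z k = 0
  · simp only [torusAct, hz, mul_zero]
    rw [← norm_eq_zero, hk, hz, norm_zero]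
  · have := norm_mul_exp_arg_mul_I (w k / z k)
    rw [norm_div, hk, div_self (norm_ne_zero_iff.2 hz), ofReal_one, one_mul] at this
    simp only [torusAct, this]
    field_simp

/-- Averaging over the torus orbits does not change the integral against a torus invariant
measure. -/
theorem integral_setIntegral_torusAct {ν : Measure (Fin n → ℂ)} [IsFiniteMeasure ν]
    (hν : ∀ θ, MeasurePreserving (torusAct θ) ν ν) {F : (Fin n → ℂ) → ℂ} (hF : Integrable F ν) :
    ∫ z, (∫ θ in Set.Icc (0 : Fin n → ℝ) fun _ => 2 * Real.pi, F (torusAct θ z)) ∂ν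
      = (2 * Real.pi) ^ n * ∫ z, F z ∂ν := by
  set τ := volume.restrict (Set.Icc (0 : Fin n → ℝ) fun _ => 2 * Real.pi) with hτ
  have : IsFiniteMeasure τ := ⟨by simp [hτ, measure_Icc_lt_top]⟩
  have hmp : MeasurePreserving (fun p : (Fin n → ℝ) × (Fin n → ℂ) => (p.1, torusAct p.1 p.2))
      (τ.prod ν) (τ.prod ν) :=
    (MeasurePreserving.id τ).skew_product continuous_torusAct.measurable
      (Filter.Eventually.of_forall fun θ => (hν θ).map_eq)
  have hint : Integrable (fun p : (Fin n → ℝ) × (Fin n → ℂ) => F (torusAct p.1 p.2)) (τ.prod ν) :=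
    hmp.integrable_comp_of_integrable (hF.comp_snd τ)
  rw [integral_integral_swap (f := fun z θ => F (torusAct θ z)) hint.swap]
  have : ∀ θ, ∫ z, F (torusAct θ z) ∂ν = ∫ z, F z ∂ν := fun θ =>
    (hν θ).integral_comp (measurableEmbedding_torusAct θ) F
  have hvol : τ.real Set.univ = (2 * Real.pi) ^ n := by
    rw [hτ, measureReal_restrict_apply_univ, measureReal_def, Pi.zero_def,
      Real.volume_Icc_pi_toReal fun _ => Real.two_pi_pos.le]
    simp
  simp only [this, integral_const, hvol, real_smul]
  push_cast
  ring

end Torus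

/-! ### The weighted measure and square integrable holomorphic functions -/

section BergmanMeasure

open MeasureTheory Complex Topology

variable {n : ℕ} {D : Set (Fin n → ℂ)} {μ : (Fin n → ℝ) → ℝ}

/-- The measure `μ(|z_1|, …, |z_n|) dv(z)` on `D`, extended by zero to `ℂⁿ`. -/
noncomputable def bergmanMeasure (D : Set (Fin n → ℂ)) (μ : (Fin n → ℝ) → ℝ) :
    Measure (Fin n → ℂ) :=
  (volume.restrict D).withDensity fun z => (Real.toNNReal (μ (moduli z)) : ℝ≥0∞)

theorem IsBoundedLogConvexCompleteReinhardt.mem_iff_of_moduli_eq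
    (hD : IsBoundedLogConvexCompleteReinhardt D) {z w : Fin n → ℂ} (h : moduli w = moduli z) :
    w ∈ D ↔ z ∈ D :=
  ⟨fun hw => hD.complete w hw z fun k => (congrFun h k).ge,
    fun hz => hD.complete z hz w fun k => (congrFun h k).le⟩

theorem IsReinhardtWeight.aemeasurable_toNNReal (hμ : IsReinhardtWeight D μ) :
    AEMeasurable (fun z => Real.toNNReal (μ (moduli z))) (volume.restrict D) :=
  hμ.integrable.aestronglyMeasurable.aemeasurable.real_toNNReal

theorem IsReinhardtWeight.isFiniteMeasure (hμ : IsReinhardtWeight D μ) :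
    IsFiniteMeasure (bergmanMeasure D μ) := by
  refine ⟨?_⟩
  rw [bergmanMeasure, withDensity_apply _ MeasurableSet.univ, Measure.restrict_univ]
  exact hμ.integrable.lintegral_lt_top

theorem bergmanMeasure_absolutelyContinuous :
    bergmanMeasure D μ ≪ volume.restrict D :=
  withDensity_absolutelyContinuous _ _

theorem ae_bergmanMeasure_mem (hD : IsOpen D) : ∀ᵐ z ∂bergmanMeasure D μ, z ∈ D :=
  bergmanMeasure_absolutelyContinuous.ae_le (ae_restrict_mem hD.measurableSet)

theorem measurePreserving_torusAct_bergmanMeasure (hD : IsBoundedLogConvexCompleteReinhardt D)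
    (μ : (Fin n → ℝ) → ℝ) (θ : Fin n → ℝ) :
    MeasurePreserving (torusAct θ) (bergmanMeasure D μ) (bergmanMeasure D μ) := by
  have hpre : torusAct θ ⁻¹' D = D :=
    Set.ext fun z => hD.mem_iff_of_moduli_eq (moduli_torusAct θ z)
  have hmp : MeasurePreserving (torusAct θ) (volume.restrict D) (volume.restrict D) := by
    have := (measurePreserving_torusAct θ).restrict_preimage_emb (measurableEmbedding_torusAct θ) D
    rwa [hpre] at this
  refine ⟨(measurableEmbedding_torusAct θ).measurable, Measure.ext fun s hs => ?_⟩
  rw [Measure.map_apply (measurableEmbedding_torusAct θ).measurable hs, bergmanMeasure,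
    withDensity_apply _ hs, withDensity_apply _ ((measurableEmbedding_torusAct θ).measurable hs),
    ← hmp.setLIntegral_comp_preimage_emb (measurableEmbedding_torusAct θ) _ s]
  simp only [moduli_torusAct]

/-- Positivity of the weight on `D`, with no lower bound, makes nonempty open sets charged. -/
theorem bergmanMeasure_pos (hμ : IsReinhardtWeight D μ) {S : Set (Fin n → ℂ)} (hS : IsOpen S)
    (hSD : S ⊆ D) (hne : S.Nonempty) : 0 < bergmanMeasure D μ S := by
  rw [pos_iff_ne_zero, bergmanMeasure, withDensity_apply _ hS.measurableSet,
    Measure.restrict_restrict hS.measurableSet, Set.inter_eq_left.2 hSD]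
  intro h
  rw [lintegral_eq_zero_iff' (hμ.aemeasurable_toNNReal.mono_measure
    (Measure.restrict_mono hSD le_rfl)).coe_nnreal_ennreal] at h
  have h2 : ∀ᵐ z ∂(volume.restrict S : Measure (Fin n → ℂ)), False := by
    filter_upwards [h, ae_restrict_mem hS.measurableSet] with z hz hzS
    have := hμ.pos (moduli z) ⟨z, hSD hzS, rfl⟩
    simp [this.not_ge] at hz
  rw [ae_iff] at h2
  simp only [not_false_eq_true, Set.ofPred_true, Measure.restrict_apply_univ] at h2
  exact (hS.measure_pos volume hne).ne' h2

theorem memBergmanSpace_iff (hD : IsOpen D) (hμ : IsReinhardtWeight D μ) {f : (Fin n → ℂ) → ℂ} :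
    MemBergmanSpace D μ f ↔ DifferentiableOn ℂ f D ∧ MemLp f 2 (bergmanMeasure D μ) := by
  refine and_congr_right fun hf => ?_
  have hm : AEStronglyMeasurable f (bergmanMeasure D μ) :=
    (hf.continuousOn.aestronglyMeasurable hD.measurableSet).mono_ac
      bergmanMeasure_absolutelyContinuous
  rw [memLp_two_iff_integrable_sq_norm hm, bergmanMeasure,
    integrable_withDensity_iff_integrable_coe_smul₀ hμ.aemeasurable_toNNReal, IntegrableOn]
  refine integrable_congr ?_
  filter_upwards [ae_restrict_mem hD.measurableSet] with z hz
  rw [Real.coe_toNNReal _ (hμ.pos _ ⟨z, hz, rfl⟩).le, smul_eq_mul, mul_comm]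

theorem integral_bergmanMeasure (hD : IsOpen D) (hμ : IsReinhardtWeight D μ)
    (g : (Fin n → ℂ) → ℂ) :
    ∫ z, g z ∂bergmanMeasure D μ = ∫ z in D, g z * (μ (moduli z) : ℂ) := by
  rw [bergmanMeasure, integral_withDensity_eq_integral_smul₀ hμ.aemeasurable_toNNReal]
  refine integral_congr_ae ?_
  filter_upwards [ae_restrict_mem hD.measurableSet] with z hz
  rw [NNReal.smul_def, Real.coe_toNNReal _ (hμ.pos _ ⟨z, hz, rfl⟩).le, real_smul, mul_comm]

end BergmanMeasure

/-! ### Holomorphic families of functionals representing evaluation -/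

section Representing

open MeasureTheory Complex Topology BoundedContinuousFunction

variable {n : ℕ}

/-- The bounded continuous function on `ℂⁿ` that is `1 / z_k` where `|z_k| ≥ ρ`. -/
noncomputable def truncatedInv (ρ : ℝ) (hρ : 0 < ρ) (k : Fin n) : (Fin n → ℂ) →ᵇ ℂ :=
  BoundedContinuousFunction.ofNormedAddCommGroup
    (fun z => conj (z k) / ((max ‖z k‖ ρ : ℝ) : ℂ) ^ 2)
    (by
      refine Continuous.div (by fun_prop) (by fun_prop) fun z => pow_ne_zero _ ?_
      exact ofReal_ne_zero.2 (lt_max_of_lt_right hρ).ne')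
    ρ⁻¹ (fun z => by
      have h : 0 < max ‖z k‖ ρ := lt_max_of_lt_right hρ
      rw [norm_div, norm_pow, norm_real, RCLike.norm_conj, Real.norm_of_nonneg h.le, pow_two,
        ← div_div, inv_eq_one_div]
      exact div_le_div₀ zero_le_one ((div_le_one h).2 (le_max_left _ _)) hρ (le_max_right _ _))

theorem norm_truncatedInv_le {ρ : ℝ} (hρ : 0 < ρ) (k : Fin n) : ‖truncatedInv ρ hρ k‖ ≤ ρ⁻¹ :=
  BoundedContinuousFunction.norm_ofNormedAddCommGroup_le _ (inv_nonneg.2 hρ.le) _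

theorem truncatedInv_apply {ρ : ℝ} (hρ : 0 < ρ) {k : Fin n} {z : Fin n → ℂ} (hz : ρ ≤ ‖z k‖) :
    truncatedInv ρ hρ k z = (z k)⁻¹ := by
  have h0 : z k ≠ 0 := norm_pos_iff.1 (hρ.trans_le hz)
  change conj (z k) / ((max ‖z k‖ ρ : ℝ) : ℂ) ^ 2 = _
  rw [max_eq_left hz, ← conj_mul']
  field_simp [h0]

/-- The Cauchy kernel `∏_k (1 - ζ_k / z_k)⁻¹` as a function of `z` depending on `ζ`, with `1 / z_k`
truncated so as to be bounded and continuous on all of `ℂⁿ`. -/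
noncomputable def cauchyFactor (ρ : Fin n → ℝ) (hρ : ∀ k, 0 < ρ k) (ζ : Fin n → ℂ) :
    (Fin n → ℂ) →ᵇ ℂ :=
  ∏ k, Ring.inverse (1 - ζ k • truncatedInv (ρ k) (hρ k) k)

theorem norm_smul_truncatedInv_lt_one {ρ : ℝ} (hρ : 0 < ρ) {k : Fin n} {c : ℂ} (hc : ‖c‖ < ρ) :
    ‖c • truncatedInv ρ hρ k‖ < 1 := by
  rw [norm_smul]
  calc ‖c‖ * ‖truncatedInv ρ hρ k‖ ≤ ‖c‖ * ρ⁻¹ := by gcongr; exact norm_truncatedInv_le hρ k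
    _ < ρ * ρ⁻¹ := by gcongr
    _ = 1 := mul_inv_cancel₀ hρ.ne'

theorem contDiffAt_cauchyFactor {ρ : Fin n → ℝ} (hρ : ∀ k, 0 < ρ k) {ζ : Fin n → ℂ}
    (hζ : ∀ k, ‖ζ k‖ < ρ k) : ContDiffAt ℂ ∞ (cauchyFactor ρ hρ) ζ := by
  refine contDiffAt_prod fun k _ => ?_
  have h := contDiffAt_ringInverse (n := ∞) ℂ 
    (Units.oneSub _ (norm_smul_truncatedInv_lt_one (k := k) (hρ k) (hζ k)))
  refine ContDiffAt.comp (f := fun ζ : Fin n → ℂ => 1 - ζ k • truncatedInv (ρ k) (hρ k) k) ζ h ?_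
  fun_prop

theorem cauchyFactor_apply {ρ : Fin n → ℝ} (hρ : ∀ k, 0 < ρ k) {ζ z : Fin n → ℂ}
    (hζ : ∀ k, ‖ζ k‖ < ρ k) (hz : ∀ k, ρ k ≤ ‖z k‖) :
    cauchyFactor ρ hρ ζ z = ∏ k, (1 - ζ k / z k)⁻¹ := by
  rw [cauchyFactor, ← BoundedContinuousFunction.coeFnMonoidHom_apply, map_prod, Finset.prod_apply]
  refine Finset.prod_congr rfl fun k _ => ?_
  set u := Units.oneSub _ (norm_smul_truncatedInv_lt_one (k := k) (hρ k) (hζ k)) with hu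
  have h : (1 - ζ k • truncatedInv (ρ k) (hρ k) k) = u := rfl
  rw [h, Ring.inverse_unit]
  have h1 : ((u⁻¹ : _) : (Fin n → ℂ) →ᵇ ℂ) z * (u : (Fin n → ℂ) →ᵇ ℂ) z = 1 := by
    rw [← BoundedContinuousFunction.mul_apply, Units.inv_mul]
    rfl
  have h2 : (u : (Fin n → ℂ) →ᵇ ℂ) z = 1 - ζ k / z k := by
    rw [← h]
    simp [truncatedInv_apply (hρ k) (hz k), div_eq_mul_inv]
  rw [← h2]
  exact eq_inv_of_mul_eq_one_left h1

theorem memLp_indicator_boundedContinuous (ν : Measure (Fin n → ℂ)) [IsFiniteMeasure ν]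
    {S : Set (Fin n → ℂ)} (hS : MeasurableSet S) (φ : (Fin n → ℂ) →ᵇ ℂ) :
    MemLp (S.indicator φ) 2 ν :=
  (MemLp.of_bound φ.continuous.aestronglyMeasurable ‖φ‖
    (Filter.Eventually.of_forall φ.norm_coe_le_norm)).indicator hS

/-- Multiplication by the indicator function of `S`, from bounded continuous functions to `L²`. -/
noncomputable def indicatorToLp (ν : Measure (Fin n → ℂ)) [IsFiniteMeasure ν]
    (S : Set (Fin n → ℂ)) (hS : MeasurableSet S) : ((Fin n → ℂ) →ᵇ ℂ) →L[ℂ] Lp ℂ 2 ν :=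
  LinearMap.mkContinuous
    { toFun := fun φ => (memLp_indicator_boundedContinuous ν hS φ).toLp
      map_add' := fun φ ψ => by
        rw [← MemLp.toLp_add]
        congr 1
        exact Set.indicator_add S φ ψ
      map_smul' := fun c φ => by
        rw [RingHom.id_apply, ← MemLp.toLp_const_smul]
        congr 1
        exact Set.indicator_const_smul S c φ }
    (measureUnivNNReal ν ^ (2 : ℝ≥0∞).toReal⁻¹ : NNReal) fun φ => by
      rw [LinearMap.coe_mk, AddHom.coe_mk]
      refine Lp.norm_le_of_ae_bound (norm_nonneg _) ?_
      filter_upwards [(memLp_indicator_boundedContinuous ν hS φ).coeFn_toLp] with z hz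
      rw [hz]
      exact (norm_indicator_le_norm_self _ _).trans (φ.norm_coe_le_norm z)

theorem coeFn_indicatorToLp (ν : Measure (Fin n → ℂ)) [IsFiniteMeasure ν]
    {S : Set (Fin n → ℂ)} (hS : MeasurableSet S) (φ : (Fin n → ℂ) →ᵇ ℂ) :
    indicatorToLp ν S hS φ =ᵐ[ν] S.indicator φ :=
  (memLp_indicator_boundedContinuous ν hS φ).coeFn_toLp

end Representing

section Representing

open MeasureTheory Complex Topology BoundedContinuousFunction

variable {n : ℕ} {D : Set (Fin n → ℂ)} {μ : (Fin n → ℝ) → ℝ}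

/-- Averaging the Cauchy formula over all tori that lie in `S = {z ∈ D : |z_k| > ρ_k}` represents
evaluation at `ζ` by the element `ν(S)⁻¹ 1_S ∏_k (1 - ζ_k / z_k)⁻¹` of `L²`, which depends
holomorphically on `ζ`. -/
theorem exists_contDiffOn_representing (hD : IsBoundedLogConvexCompleteReinhardt D)
    (hμ : IsReinhardtWeight D μ) {ζ₀ : Fin n → ℂ} (hζ₀ : ζ₀ ∈ D) :
    ∃ V : Set (Fin n → ℂ), IsOpen V ∧ ζ₀ ∈ V ∧ V ⊆ D ∧
      ∃ Ψ : (Fin n → ℂ) → Lp ℂ 2 (bergmanMeasure D μ), ContDiffOn ℂ ∞ Ψ V ∧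
        ∀ ζ ∈ V, ∀ f, DifferentiableOn ℂ f D → MemLp f 2 (bergmanMeasure D μ) →
          ∫ z, f z * Ψ ζ z ∂bergmanMeasure D μ = f ζ := by
  set ν := bergmanMeasure D μ with hν
  have hfin : IsFiniteMeasure ν := hμ.isFiniteMeasure
  have hmod : (fun k => (‖ζ₀ k‖ : ℂ)) ∈ D := hD.complete ζ₀ hζ₀ _ fun k => by simp
  obtain ⟨ε, hε, hball⟩ := Metric.isOpen_iff.1 hD.isOpen _ hmod
  have hw : (fun k => (‖ζ₀ k‖ : ℂ) + (ε / 2 : ℝ)) ∈ D := by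
    refine hball ?_
    rw [Metric.mem_ball, dist_pi_lt_iff hε]
    intro k
    rw [dist_eq_norm, add_sub_cancel_left, norm_real, Real.norm_of_nonneg (by positivity)]
    linarith
  have hnw : ∀ k, ‖(‖ζ₀ k‖ : ℂ) + (ε / 2 : ℝ)‖ = ‖ζ₀ k‖ + ε / 2 := fun k => by
    rw [← ofReal_add, norm_real, Real.norm_of_nonneg (by positivity)]
  set ρ : Fin n → ℝ := fun k => ‖ζ₀ k‖ + ε / 4 with hρdef
  have hρ : ∀ k, 0 < ρ k := fun k => by positivity
  set S : Set (Fin n → ℂ) := D ∩ ⋂ k, {z | ρ k < ‖z k‖} with hSdef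
  have hSmem : ∀ z, z ∈ S ↔ z ∈ D ∧ ∀ k, ρ k < ‖z k‖ := fun z => by simp [hSdef]
  have hSo : IsOpen S := hD.isOpen.inter
    (isOpen_iInter_of_finite fun k => isOpen_lt continuous_const (by fun_prop))
  have hSm := hSo.measurableSet
  have hSpos : 0 < ν S := bergmanMeasure_pos hμ hSo Set.inter_subset_left
    ⟨_, (hSmem _).2 ⟨hw, fun k => by rw [hnw k]; simp only [hρdef]; linarith⟩⟩
  have hm : (ν.real S : ℂ) ≠ 0 := by
    rw [ofReal_ne_zero, measureReal_def]
    exact (ENNReal.toReal_pos hSpos.ne' (measure_ne_top _ _)).ne'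
  set V : Set (Fin n → ℂ) := ⋂ k, {ζ | ‖ζ k‖ < ρ k} with hVdef
  have hVmem : ∀ z, z ∈ V ↔ ∀ k, ‖z k‖ < ρ k := fun z => by simp [hVdef]
  refine ⟨V, isOpen_iInter_of_finite fun k => isOpen_lt (by fun_prop) continuous_const,
    (hVmem _).2 fun k => by simp only [hρdef]; linarith, fun ζ hζ => ?_,
    fun ζ => (ν.real S : ℂ)⁻¹ • indicatorToLp ν S hSm (cauchyFactor ρ hρ ζ), ?_, ?_⟩
  · refine hD.complete _ hw ζ fun k => ?_
    rw [hnw k]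
    have := (hVmem ζ).1 hζ k
    simp only [hρdef] at this
    linarith
  · intro ζ hζ
    have h := contDiffAt_cauchyFactor hρ ((hVmem ζ).1 hζ)
    exact (((indicatorToLp ν S hSm).contDiff.contDiffAt.comp ζ h).const_smul _).contDiffWithinAt
  · intro ζ hζ f hf hfL
    rw [hVmem] at hζ
    set F : (Fin n → ℂ) → ℂ := fun z => f z * S.indicator (cauchyFactor ρ hρ ζ) z with hF
    have hFint : Integrable F ν :=
      hfL.integrable_mul (memLp_indicator_boundedContinuous ν hSm (cauchyFactor ρ hρ ζ))
    have havg := integral_setIntegral_torusAct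
      (measurePreserving_torusAct_bergmanMeasure hD μ) hFint
    have hinner : ∀ z, ∫ θ in Set.Icc (0 : Fin n → ℝ) fun _ => 2 * Real.pi, F (torusAct θ z)
        = S.indicator (fun _ => (2 * Real.pi : ℂ) ^ n * f ζ) z := by
      intro z
      have hT : ∀ θ, torusAct θ z ∈ S ↔ z ∈ S := fun θ => by
        simp only [hSmem, norm_torusAct, hD.mem_iff_of_moduli_eq (moduli_torusAct θ z)]
      by_cases hz : z ∈ S
      · rw [Set.indicator_of_mem hz, ← setIntegral_torusAct_mul_prod f z ζ
          (fun w hw => hf.differentiableAt (hD.isOpen.mem_nhds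
            (hD.complete z ((hSmem z).1 hz).1 w hw))) fun k => (hζ k).trans (((hSmem z).1 hz).2 k)]
        refine integral_congr_ae (Filter.Eventually.of_forall fun θ => ?_)
        simp only [hF]
        rw [Set.indicator_of_mem ((hT θ).2 hz), cauchyFactor_apply hρ hζ fun k =>
          (((hSmem _).1 ((hT θ).2 hz)).2 k).le]
      · rw [Set.indicator_of_notMem hz]
        simp [hF, hT, hz]
    simp only [hinner] at havg
    rw [integral_indicator_const _ hSm, real_smul, mul_left_comm] at havg
    have h2π : ((2 * Real.pi : ℂ)) ^ n ≠ 0 := pow_ne_zero _ (by simp [Real.pi_ne_zero])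
    have havg' := mul_left_cancel₀ h2π havg
    have hΨ : (fun z => f z * ((ν.real S : ℂ)⁻¹ • indicatorToLp ν S hSm (cauchyFactor ρ hρ ζ) :
        Lp ℂ 2 ν) z) =ᵐ[ν] fun z => (ν.real S : ℂ)⁻¹ * F z := by
      filter_upwards [Lp.coeFn_smul (ν.real S : ℂ)⁻¹ (indicatorToLp ν S hSm (cauchyFactor ρ hρ ζ)),
        coeFn_indicatorToLp ν hSm (cauchyFactor ρ hρ ζ)] with z h1 h2
      rw [h1, Pi.smul_apply, h2, smul_eq_mul, hF]
      ring
    rw [integral_congr_ae hΨ, integral_const_mul, ← havg', inv_mul_cancel_left₀ hm]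

end Representing

/-! ### The Bergman kernel on the diagonal -/

section Kernel

open MeasureTheory Complex Topology Filter

variable {n : ℕ} {D : Set (Fin n → ℂ)} {μ : (Fin n → ℝ) → ℝ}

/-- The subspace of `L²(ν)` of the complex conjugates of functions holomorphic on `D`. -/
def conjBergmanSpace (D : Set (Fin n → ℂ)) (ν : Measure (Fin n → ℂ)) :
    Submodule ℂ (Lp ℂ 2 ν) where
  carrier := {F | ∃ f : (Fin n → ℂ) → ℂ, DifferentiableOn ℂ f D ∧ F =ᵐ[ν] fun z => conj (f z)}
  add_mem' := by
    rintro F G ⟨f, hf, hF⟩ ⟨g, hg, hG⟩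
    refine ⟨f + g, hf.add hg, ?_⟩
    filter_upwards [Lp.coeFn_add F G, hF, hG] with z h h1 h2
    rw [h, Pi.add_apply, h1, h2, Pi.add_apply, map_add]
  zero_mem' := by
    refine ⟨0, differentiableOn_const 0, ?_⟩
    filter_upwards [Lp.coeFn_zero ℂ 2 ν] with z h
    rw [h]
    simp
  smul_mem' := by
    rintro c F ⟨f, hf, hF⟩
    refine ⟨conj c • f, hf.const_smul _, ?_⟩
    filter_upwards [Lp.coeFn_smul c F, hF] with z h h1
    simp [h, h1]

/-- In terms of the inner product of `L²`, which is conjugate linear in its first argument,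
evaluation at `ζ` of a holomorphic function is represented by a vector depending holomorphically
on `ζ`. -/
theorem exists_contDiffOn_inner_eq (hD : IsBoundedLogConvexCompleteReinhardt D)
    (hμ : IsReinhardtWeight D μ) {ζ₀ : Fin n → ℂ} (hζ₀ : ζ₀ ∈ D) :
    ∃ V : Set (Fin n → ℂ), IsOpen V ∧ ζ₀ ∈ V ∧ V ⊆ D ∧
      ∃ Ψ : (Fin n → ℂ) → Lp ℂ 2 (bergmanMeasure D μ), ContDiffOn ℂ ∞ Ψ V ∧
        ∀ ζ ∈ V, ∀ (F : Lp ℂ 2 (bergmanMeasure D μ)) (f : (Fin n → ℂ) → ℂ),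
          DifferentiableOn ℂ f D → F =ᵐ[bergmanMeasure D μ] (fun z => conj (f z)) →
          inner ℂ F (Ψ ζ) = f ζ := by
  obtain ⟨V, hVo, hζV, hVD, Ψ, hΨ, hrep⟩ := exists_contDiffOn_representing hD hμ hζ₀
  refine ⟨V, hVo, hζV, hVD, Ψ, hΨ, fun ζ hζ F f hf hF => ?_⟩
  have hfL : MemLp f 2 (bergmanMeasure D μ) := by
    refine ((memLp_congr_ae ?_).1 (Lp.memLp F).star)
    filter_upwards [hF] with z hz
    simp [hz]
  rw [← hrep ζ hζ f hf hfL, L2.inner_def]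
  refine integral_congr_ae ?_
  filter_upwards [hF] with z hz
  rw [hz, RCLike.inner_apply, conj_conj, mul_comm]

/-- An `L²` limit `F` of conjugates of holomorphic functions is the conjugate of a holomorphic
function: the pairing of `F` with the vectors representing evaluation depends holomorphically
on the point of evaluation. -/
theorem isClosed_conjBergmanSpace (hD : IsBoundedLogConvexCompleteReinhardt D)
    (hμ : IsReinhardtWeight D μ) :
    IsClosed (conjBergmanSpace D (bergmanMeasure D μ) : Set (Lp ℂ 2 (bergmanMeasure D μ))) := by
  refine IsSeqClosed.isClosed fun F G hF hFG => ?_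
  choose f hf hFf using hF
  choose! V hVo hζV hVD Ψ hΨ hrep using fun ζ₀ (h : ζ₀ ∈ D) => exists_contDiffOn_inner_eq hD hμ h
  have hlim : ∀ ζ₀ ∈ D, ∀ ζ ∈ V ζ₀, Tendsto (fun j => f j ζ) atTop (𝓝 (inner ℂ G (Ψ ζ₀ ζ))) := by
    intro ζ₀ h₀ ζ hζ
    refine (hFG.inner (tendsto_const_nhds (x := Ψ ζ₀ ζ))).congr fun j => ?_
    exact hrep ζ₀ h₀ ζ hζ (F j) (f j) (hf j) (hFf j)
  refine ⟨fun ζ => inner ℂ G (Ψ ζ ζ), fun ζ₀ h₀ => ?_, ?_⟩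
  · refine DifferentiableAt.differentiableWithinAt ?_
    have hd : DifferentiableAt ℂ (fun ζ => inner ℂ G (Ψ ζ₀ ζ)) ζ₀ :=
      (innerSL ℂ G).differentiableAt.comp ζ₀ (((hΨ ζ₀ h₀).contDiffAt
        ((hVo ζ₀ h₀).mem_nhds (hζV ζ₀ h₀))).differentiableAt (by simp))
    refine hd.congr_of_eventuallyEq ?_
    filter_upwards [(hVo ζ₀ h₀).mem_nhds (hζV ζ₀ h₀)] with ζ hζ
    exact tendsto_nhds_unique (hlim ζ (hVD ζ₀ h₀ hζ) ζ (hζV ζ (hVD ζ₀ h₀ hζ)))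
      (hlim ζ₀ h₀ ζ hζ)
  · obtain ⟨ns, hns, hae⟩ := (tendstoInMeasure_of_tendsto_Lp hFG).exists_seq_tendsto_ae
    filter_upwards [hae, ae_all_iff.2 hFf, ae_bergmanMeasure_mem hD.isOpen] with z h1 h2 hz
    refine tendsto_nhds_unique h1 ?_
    simp only [h2]
    exact (continuous_conj.tendsto _).comp ((hlim z hz z (hζV z hz)).comp hns.tendsto_atTop)

/-- Two functions that represent evaluation at `ζ` agree at `ζ`. -/
theorem IsReproducingAt.apply_eq {ζ : Fin n → ℂ} {k k' : (Fin n → ℂ) → ℂ}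
    (h : IsReproducingAt D μ ζ k) (h' : IsReproducingAt D μ ζ k') : k ζ = k' ζ := by
  have hconj : ∀ f g : (Fin n → ℂ) → ℂ, conj (∫ z in D, f z * conj (g z) * (μ (moduli z) : ℂ))
      = ∫ z in D, g z * conj (f z) * (μ (moduli z) : ℂ) := fun f g => by
    rw [← integral_conj]
    refine integral_congr_ae (Eventually.of_forall fun z => ?_)
    simp only [map_mul, conj_conj, conj_ofReal]
    ring
  have h1 : conj (k ζ) = k ζ := by rw [h.2 k h.1, hconj]
  calc k ζ = conj (k ζ) := h1.symm
    _ = k' ζ := by rw [h'.2 k h.1, hconj, ← h.2 k' h'.1]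

theorem IsReproducingAt.bergmanKernel_eq {ζ : Fin n → ℂ} {k : (Fin n → ℂ) → ℂ}
    (h : IsReproducingAt D μ ζ k) : bergmanKernel D μ ζ ζ = k ζ := by
  have hex : ∃ k, IsReproducingAt D μ ζ k := ⟨k, h⟩
  rw [bergmanKernel, dif_pos hex]
  exact hex.choose_spec.apply_eq h

/-- Near each point of `D`, evaluation is represented by a holomorphic map `Φ` to a Hilbert space,
and the Bergman kernel on the diagonal is `‖Φ‖²`. -/
theorem exists_bergmanKernel_eq_norm_sq (hD : IsBoundedLogConvexCompleteReinhardt D)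
    (hμ : IsReinhardtWeight D μ) {ζ₀ : Fin n → ℂ} (hζ₀ : ζ₀ ∈ D) :
    ∃ V : Set (Fin n → ℂ), IsOpen V ∧ ζ₀ ∈ V ∧ V ⊆ D ∧
      ∃ Φ : (Fin n → ℂ) → Lp ℂ 2 (bergmanMeasure D μ), ContDiffOn ℂ ∞ Φ V ∧
        (∀ ζ ∈ V, ∀ (F : Lp ℂ 2 (bergmanMeasure D μ)) (f : (Fin n → ℂ) → ℂ),
          DifferentiableOn ℂ f D → F =ᵐ[bergmanMeasure D μ] (fun z => conj (f z)) →
          inner ℂ F (Φ ζ) = f ζ) ∧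
        ∀ ζ ∈ V, ∃ k, IsReproducingAt D μ ζ k ∧ k ζ = (‖Φ ζ‖ ^ 2 : ℝ) := by
  obtain ⟨V, hVo, hζV, hVD, Ψ, hΨ, hrep⟩ := exists_contDiffOn_inner_eq hD hμ hζ₀
  set B := conjBergmanSpace D (bergmanMeasure D μ) with hB
  have hcomplete : CompleteSpace B := (isClosed_conjBergmanSpace hD hμ).completeSpace_coe
  have hrep' : ∀ ζ ∈ V, ∀ (F : Lp ℂ 2 (bergmanMeasure D μ)) (f : (Fin n → ℂ) → ℂ),
      DifferentiableOn ℂ f D → F =ᵐ[bergmanMeasure D μ] (fun z => conj (f z)) →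
      inner ℂ F (B.starProjection (Ψ ζ)) = f ζ := by
    intro ζ hζ F f hf hF
    have hFB : F ∈ B := ⟨f, hf, hF⟩
    rw [← B.inner_starProjection_left_eq_right, B.starProjection_eq_self_iff.2 hFB,
      hrep ζ hζ F f hf hF]
  refine ⟨V, hVo, hζV, hVD, fun ζ => B.starProjection (Ψ ζ),
    B.starProjection.contDiff.comp_contDiffOn hΨ, hrep', fun ζ hζ => ?_⟩
  obtain ⟨k, hk, hΦk⟩ : B.starProjection (Ψ ζ) ∈ B := B.starProjection_apply_mem _
  refine ⟨k, ⟨(memBergmanSpace_iff hD.isOpen hμ).2 ⟨hk, ?_⟩, fun f hf => ?_⟩, ?_⟩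
  · refine (memLp_congr_ae ?_).1 (Lp.memLp (B.starProjection (Ψ ζ))).star
    filter_upwards [hΦk] with z hz
    simp [hz]
  · obtain ⟨hf, hfL⟩ := (memBergmanSpace_iff hD.isOpen hμ).1 hf
    have hcf := hfL.star.coeFn_toLp
    rw [← integral_bergmanMeasure hD.isOpen hμ (fun z => f z * conj (k z)),
      ← hrep' ζ hζ hfL.star.toLp f hf hcf, L2.inner_def]
    refine integral_congr_ae ?_
    filter_upwards [hcf, hΦk] with z h1 h2
    rw [h1, h2, RCLike.inner_apply, Pi.star_apply, RCLike.star_def, conj_conj, mul_comm]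
  · rw [← hrep' ζ hζ _ k hk hΦk, inner_self_eq_norm_sq_to_K]
    simp

theorem MemBergmanSpace.comp_torusAct (hD : IsBoundedLogConvexCompleteReinhardt D)
    (hμ : IsReinhardtWeight D μ) {f : (Fin n → ℂ) → ℂ} (hf : MemBergmanSpace D μ f)
    (θ : Fin n → ℝ) : MemBergmanSpace D μ fun z => f (torusAct θ z) := by
  obtain ⟨h1, h2⟩ := (memBergmanSpace_iff hD.isOpen hμ).1 hf
  refine (memBergmanSpace_iff hD.isOpen hμ).2 ⟨h1.comp (t := D) ?_ fun z hz => ?_,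
    h2.comp_measurePreserving (measurePreserving_torusAct_bergmanMeasure hD μ θ)⟩
  · unfold torusAct
    fun_prop
  · exact (hD.mem_iff_of_moduli_eq (moduli_torusAct θ z)).2 hz

theorem IsReproducingAt.comp_torusAct (hD : IsBoundedLogConvexCompleteReinhardt D)
    (hμ : IsReinhardtWeight D μ) {ζ : Fin n → ℂ} {k : (Fin n → ℂ) → ℂ}
    (hk : IsReproducingAt D μ ζ k) (θ : Fin n → ℝ) :
    IsReproducingAt D μ (torusAct θ ζ) fun z => k (torusAct (-θ) z) := by
  refine ⟨hk.1.comp_torusAct hD hμ _, fun f hf => ?_⟩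
  have := hk.2 _ (hf.comp_torusAct hD hμ θ)
  rw [this, ← integral_bergmanMeasure hD.isOpen hμ (fun z => f (torusAct θ z) * conj (k z)),
    ← integral_bergmanMeasure hD.isOpen hμ (fun z => f z * conj (k (torusAct (-θ) z))),
    ← (measurePreserving_torusAct_bergmanMeasure hD μ θ).integral_comp
      (measurableEmbedding_torusAct θ) (fun z => f z * conj (k (torusAct (-θ) z)))]
  exact integral_congr_ae (Eventually.of_forall fun z => by simp only [torusAct_neg_torusAct])

theorem bergmanKernel_eq_of_moduli_eq (hD : IsBoundedLogConvexCompleteReinhardt D)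
    (hμ : IsReinhardtWeight D μ) {z w : Fin n → ℂ} (hz : z ∈ D) (h : moduli w = moduli z) :
    bergmanKernel D μ w w = bergmanKernel D μ z z := by
  obtain ⟨V, -, hzV, -, Φ, -, -, hk⟩ := exists_bergmanKernel_eq_norm_sq hD hμ hz
  obtain ⟨k, hk, -⟩ := hk z hzV
  obtain ⟨θ, rfl⟩ := torus_transitive h
  rw [hk.bergmanKernel_eq, (hk.comp_torusAct hD hμ θ).bergmanKernel_eq, torusAct_neg_torusAct]

end Kernel

/-! ### The Levi form of a real potential -/

section Levi

open Complex Topology Filter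

variable {n : ℕ}

/-- The real part `(D²g(u, v) + D²g(iu, iv)) / 4` of the Levi form of `g` at `z`. -/
noncomputable def leviForm (g : (Fin n → ℂ) → ℝ) (z u v : Fin n → ℂ) : ℝ :=
  (fderiv ℝ (fderiv ℝ g) z u v + fderiv ℝ (fderiv ℝ g) z (I • u) (I • v)) / 4

/-- The Levi form `∑ ∂²g/∂z_k∂z̄_l u_k v̄_l` associated with a real bilinear form `B = D²g`. -/
noncomputable def complexLeviForm (B : (Fin n → ℂ) →L[ℝ] (Fin n → ℂ) →L[ℝ] ℝ) :
    (Fin n → ℂ) →ₗ[ℂ] (Fin n → ℂ) →ₛₗ[starRingEnd ℂ] ℂ :=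
  LinearMap.mk₂'ₛₗ (RingHom.id ℂ) (starRingEnd ℂ)
    (fun u v => ((B u v : ℂ) + B (I • u) (I • v) + I * (B u (I • v) - B (I • u) v)) / 4)
    (fun u u' v => by simp only [smul_add, map_add, _root_.add_apply, ofReal_add]; ring)
    (fun c u v => by
      have h1 : c • u = c.re • u + c.im • (I • u) := by
        conv_lhs => rw [← re_add_im c]
        rw [add_smul, mul_smul, coe_smul, coe_smul]
      have h2 : I • c • u = c.re • (I • u) - c.im • u := by
        rw [h1, smul_add, smul_comm I c.re, smul_comm I c.im, smul_smul I I, I_mul_I]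
        simp [sub_eq_add_neg]
      rw [h2, h1]
      simp only [map_add, map_sub, map_smul, _root_.add_apply,
        _root_.sub_apply, _root_.smul_apply, smul_eq_mul, ofReal_add,
        ofReal_sub, ofReal_mul, RingHom.id_apply]
      conv_rhs => rw [← re_add_im c]
      linear_combination (-c.im / 4 * (B u (I • v) - B (I • u) v) : ℂ) * I_sq)
    (fun u v v' => by simp only [smul_add, map_add, ofReal_add]; ring)
    (fun c u v => by
      have h1 : c • v = c.re • v + c.im • (I • v) := by
        conv_lhs => rw [← re_add_im c]
        rw [add_smul, mul_smul, coe_smul, coe_smul]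
      have h2 : I • c • v = c.re • (I • v) - c.im • v := by
        rw [h1, smul_add, smul_comm I c.re, smul_comm I c.im, smul_smul I I, I_mul_I]
        simp [sub_eq_add_neg]
      rw [h2, h1]
      simp only [map_add, map_sub, map_smul, smul_eq_mul, ofReal_add, ofReal_sub, ofReal_mul]
      have hc : conj c = c.re - c.im * I := by
        apply Complex.ext <;> simp
      rw [hc]
      linear_combination (c.im / 4 * (B u (I • v) - B (I • u) v) : ℂ) * I_sq)

theorem complexLeviForm_apply (B : (Fin n → ℂ) →L[ℝ] (Fin n → ℂ) →L[ℝ] ℝ) (u v : Fin n → ℂ) :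
    complexLeviForm B u v
      = ((B u v : ℂ) + B (I • u) (I • v) + I * (B u (I • v) - B (I • u) v)) / 4 := rfl

theorem dz_dzbar_ofReal {g : (Fin n → ℂ) → ℝ} {z : Fin n → ℂ} (hg : ContDiffAt ℝ 2 g z)
    (k l : Fin n) :
    dz k (dzbar l fun w => (g w : ℂ)) z
      = complexLeviForm (fderiv ℝ (fderiv ℝ g) z) (Pi.single k 1) (Pi.single l 1) := by
  have hI : ∀ k : Fin n, (Pi.single k I : Fin n → ℂ) = I • Pi.single k (1 : ℂ) := fun k => by
    rw [← Pi.single_smul, smul_eq_mul, mul_one]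
  have h1 : ∀ᶠ w in 𝓝 z, DifferentiableAt ℝ g w :=
    (hg.eventually (by simp)).mono fun w hw => hw.differentiableAt (by simp)
  have h2 : HasFDerivAt (fderiv ℝ g) (fderiv ℝ (fderiv ℝ g) z) z :=
    ((hg.fderiv_right (m := 1) (by norm_num)).differentiableAt (by simp)).hasFDerivAt
  have h3 : (dzbar l fun w => (g w : ℂ)) =ᶠ[𝓝 z] fun w =>
      ((fderiv ℝ g w (Pi.single l 1) : ℂ) + I * fderiv ℝ g w (Pi.single l I)) / 2 := by
    filter_upwards [h1] with w hw
    have : fderiv ℝ (fun w => (g w : ℂ)) w = ofRealCLM.comp (fderiv ℝ g w) :=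
      (ofRealCLM.hasFDerivAt.comp w hw.hasFDerivAt).fderiv
    simp [dzbar, this]
  have h4 : ∀ v, HasFDerivAt (fun w => (fderiv ℝ g w v : ℂ))
      (ofRealCLM.comp ((ContinuousLinearMap.apply ℝ ℝ v).comp (fderiv ℝ (fderiv ℝ g) z))) z :=
    fun v => ofRealCLM.hasFDerivAt.comp z
      ((ContinuousLinearMap.apply ℝ ℝ v).hasFDerivAt.comp z h2)
  have h5 := (((h4 (Pi.single l 1)).fun_add ((h4 (Pi.single l I)).const_mul I)).mul_const
    (2 : ℂ)⁻¹)
  simp only [← div_eq_mul_inv] at h5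
  have h6 : fderiv ℝ (dzbar l fun w => (g w : ℂ)) z = _ := h3.fderiv_eq.trans h5.fderiv
  rw [dz, h6, complexLeviForm_apply]
  simp only [_root_.smul_apply, _root_.add_apply,
    ContinuousLinearMap.comp_apply, ContinuousLinearMap.apply_apply, ofRealCLM_apply, smul_eq_mul,
    hI]
  linear_combination (-(fderiv ℝ (fderiv ℝ g) z (I • Pi.single k 1) (I • Pi.single l 1) : ℂ) / 4)
    * I_sq

theorem sum_complexLeviForm (B : (Fin n → ℂ) →L[ℝ] (Fin n → ℂ) →L[ℝ] ℝ) (u v : Fin n → ℂ) :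
    ∑ k, ∑ l, complexLeviForm B (Pi.single k 1) (Pi.single l 1) * u k * conj (v l)
      = complexLeviForm B u v := by
  have h : ∀ u : Fin n → ℂ, u = ∑ k, u k • Pi.single k (1 : ℂ) := pi_eq_sum_univ'
  conv_rhs => rw [h u, h v]
  simp only [map_sum, LinearMap.sum_apply, map_smul, LinearMap.smul_apply, LinearMap.map_smulₛₗ,
    smul_eq_mul]
  rw [Finset.sum_comm]
  refine Finset.sum_congr rfl fun k _ => ?_
  rw [Finset.mul_sum]
  exact Finset.sum_congr rfl fun l _ => by ring

theorem re_complexLeviForm (g : (Fin n → ℂ) → ℝ) (z u v : Fin n → ℂ) :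
    (complexLeviForm (fderiv ℝ (fderiv ℝ g) z) u v).re = leviForm g z u v := by
  rw [complexLeviForm_apply, leviForm]
  simp [← ofReal_sub]

theorem fderiv_fderiv_apply {g : (Fin n → ℂ) → ℝ} {z : Fin n → ℂ} (hg : ContDiffAt ℝ 2 g z)
    (u v : Fin n → ℂ) :
    fderiv ℝ (fun w => fderiv ℝ g w v) z u = fderiv ℝ (fderiv ℝ g) z u v := by
  have h2 : HasFDerivAt (fderiv ℝ g) (fderiv ℝ (fderiv ℝ g) z) z :=
    ((hg.fderiv_right (m := 1) (by norm_num)).differentiableAt (by simp)).hasFDerivAt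
  exact congrArg (· u) ((ContinuousLinearMap.apply ℝ ℝ v).hasFDerivAt.comp z h2).fderiv

theorem fderiv_fderiv_comp {g : (Fin n → ℂ) → ℝ} {z : Fin n → ℂ}
    (L : (Fin n → ℂ) →L[ℝ] (Fin n → ℂ)) (hg : ContDiffAt ℝ 2 g z) (hgL : ContDiffAt ℝ 2 g (L z))
    (h : (fun w => g (L w)) =ᶠ[𝓝 z] g) (u v : Fin n → ℂ) :
    fderiv ℝ (fderiv ℝ g) (L z) (L u) (L v) = fderiv ℝ (fderiv ℝ g) z u v := by
  have h1 : ∀ᶠ w in 𝓝 z, DifferentiableAt ℝ g (L w) :=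
    L.continuous.continuousAt.eventually
      ((hgL.eventually (by simp)).mono fun w hw => hw.differentiableAt (by simp))
  have h2 : (fun w => fderiv ℝ g w v) =ᶠ[𝓝 z] fun w => fderiv ℝ g (L w) (L v) := by
    filter_upwards [eventually_eventually_nhds.2 h, h1] with w hw hdw
    rw [← EventuallyEq.fderiv_eq hw]
    exact congrArg (· v) (hdw.hasFDerivAt.comp w L.hasFDerivAt).fderiv
  rw [← fderiv_fderiv_apply hg, ← fderiv_fderiv_apply hgL, h2.fderiv_eq]
  have h3 : DifferentiableAt ℝ (fun w => fderiv ℝ g w (L v)) (L z) :=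
    ((hgL.fderiv_right (m := 1) (by norm_num)).differentiableAt (by simp)).clm_apply (by fun_prop)
  exact (congrArg (· u) (h3.hasFDerivAt.comp z L.hasFDerivAt).fderiv).symm

/-- Real linear maps that commute or anticommute with `i` and preserve `g` preserve the Levi form
of `g`. -/
theorem leviForm_comp {g : (Fin n → ℂ) → ℝ} {z : Fin n → ℂ}
    (L : (Fin n → ℂ) →L[ℝ] (Fin n → ℂ)) (hg : ContDiffAt ℝ 2 g z) (hgL : ContDiffAt ℝ 2 g (L z))
    (h : (fun w => g (L w)) =ᶠ[𝓝 z] g)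
    (hL : (∀ u, L (I • u) = I • L u) ∨ ∀ u, L (I • u) = -(I • L u)) (u v : Fin n → ℂ) :
    leviForm g (L z) (L u) (L v) = leviForm g z u v := by
  rw [leviForm, leviForm, fderiv_fderiv_comp L hg hgL h,
    ← fderiv_fderiv_comp L hg hgL h (I • u) (I • v)]
  rcases hL with hL | hL <;> simp [hL]

variable {F : Type*} [NormedAddCommGroup F] [InnerProductSpace ℂ F]

/-- For holomorphic `Φ`, the second derivatives `D²Φ` cancel in the Levi form of `log ‖Φ‖²`,
because `D²Φ(iu, iu) = -D²Φ(u, u)`. -/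
theorem leviForm_log_norm_sq {Φ : (Fin n → ℂ) → F} {V : Set (Fin n → ℂ)} (hV : IsOpen V)
    (hΦ : ContDiffOn ℂ ∞ Φ V) (h0 : ∀ w ∈ V, Φ w ≠ 0) {g : (Fin n → ℂ) → ℝ}
    (hg : ∀ w ∈ V, g w = Real.log (‖Φ w‖ ^ 2)) {z : Fin n → ℂ} (hz : z ∈ V) (u : Fin n → ℂ) :
    ContDiffAt ℝ ∞ g z ∧ leviForm g z u u = (‖Φ z‖ ^ 2 * ‖fderiv ℂ Φ z u‖ ^ 2
      - ‖inner ℂ (Φ z) (fderiv ℂ Φ z u)‖ ^ 2) / ‖Φ z‖ ^ 4 := by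
  let : InnerProductSpace ℝ F := InnerProductSpace.rclikeToReal ℂ F
  have hVz := hV.mem_nhds hz
  have hN : ∀ w ∈ V, ‖Φ w‖ ^ 2 ≠ 0 := fun w hw => pow_ne_zero _ (norm_ne_zero_iff.2 (h0 w hw))
  have hsm : ContDiffAt ℝ ∞ g z := by
    have h1 : ContDiffAt ℝ ∞ (fun w => Real.log (‖Φ w‖ ^ 2)) z :=
      (((hΦ.contDiffAt hVz).restrict_scalars ℝ).norm_sq ℂ).log (hN z hz)
    refine h1.congr_of_eventuallyEq ?_
    filter_upwards [hVz] with w hw using hg w hw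
  refine ⟨hsm, ?_⟩
  have hd : ∀ w ∈ V, HasFDerivAt Φ (fderiv ℂ Φ w) w := fun w hw =>
    ((hΦ.contDiffAt (hV.mem_nhds hw)).differentiableAt (by simp)).hasFDerivAt
  have hdR : ∀ w ∈ V, HasFDerivAt Φ ((fderiv ℂ Φ w).restrictScalars ℝ) w := fun w hw =>
    (hd w hw).restrictScalars ℝ
  have hNd : ∀ w ∈ V, ∀ v, fderiv ℝ g w v
      = 2 * inner ℝ (Φ w) (fderiv ℂ Φ w v) / ‖Φ w‖ ^ 2 := by
    intro w hw v
    have e1 : g =ᶠ[𝓝 w] fun w => Real.log (‖Φ w‖ ^ 2) := by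
      filter_upwards [hV.mem_nhds hw] with x hx using hg x hx
    rw [e1.fderiv_eq, ((hdR w hw).norm_sq.log (hN w hw)).fderiv]
    simp
    ring
  have hd2 : HasFDerivAt (fderiv ℂ Φ) (fderiv ℂ (fderiv ℂ Φ) z) z :=
    (((hΦ.contDiffAt hVz).fderiv_right (m := 1) (by norm_cast)).differentiableAt
      (by simp)).hasFDerivAt
  have hsnd : ∀ v, fderiv ℝ (fderiv ℝ g) z v v
      = 2 * (‖fderiv ℂ Φ z v‖ ^ 2 + inner ℝ (Φ z) (fderiv ℂ (fderiv ℂ Φ) z v v)) / ‖Φ z‖ ^ 2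
        - (2 * inner ℝ (Φ z) (fderiv ℂ Φ z v)) ^ 2 / ‖Φ z‖ ^ 4 := by
    intro v
    have hsm2 : ContDiffAt ℝ 2 g z := hsm.of_le (by norm_cast)
    have hφ : DifferentiableAt ℝ (fun w => fderiv ℝ g w v) z :=
      ((hsm2.fderiv_right (m := 1) (by norm_num)).differentiableAt (by simp)).clm_apply
        (by fun_prop)
    have hline : HasDerivAt (fun t : ℝ => z + t • v) v 0 := by
      simpa using ((hasDerivAt_id (0 : ℝ)).smul_const v).const_add z
    have hz0 : z = z + (0 : ℝ) • v := by simp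
    have d1 : HasDerivAt (fun t : ℝ => Φ (z + t • v)) (fderiv ℂ Φ z v) 0 :=
      (hdR z hz).comp_hasDerivAt_of_eq 0 hline hz0
    have d2 : HasDerivAt (fun t : ℝ => fderiv ℂ Φ (z + t • v) v)
        (fderiv ℂ (fderiv ℂ Φ) z v v) 0 :=
      (((ContinuousLinearMap.apply ℂ F v).hasFDerivAt.comp z hd2).restrictScalars
        ℝ).comp_hasDerivAt_of_eq 0 hline hz0
    have d3 := ((d1.inner ℝ d2).const_mul 2).fun_div d1.norm_sq
      (by simpa using hN z hz)
    have d4 : HasDerivAt (fun t : ℝ => fderiv ℝ g (z + t • v) v)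
        (fderiv ℝ (fun w => fderiv ℝ g w v) z v) 0 :=
      hφ.hasFDerivAt.comp_hasDerivAt_of_eq 0 hline hz0
    have d5 : (fun t : ℝ => fderiv ℝ g (z + t • v) v) =ᶠ[𝓝 0] fun t : ℝ =>
        2 * inner ℝ (Φ (z + t • v)) (fderiv ℂ Φ (z + t • v) v) / ‖Φ (z + t • v)‖ ^ 2 := by
      have : ∀ᶠ t : ℝ in 𝓝 0, z + t • v ∈ V :=
        hline.continuousAt.eventually (by simpa using hVz)
      filter_upwards [this] with t ht using hNd _ ht v
    rw [← fderiv_fderiv_apply hsm2, (d4.congr_of_eventuallyEq d5.symm).unique d3]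
    have hn0 : ‖Φ z‖ ≠ 0 := norm_ne_zero_iff.2 (h0 z hz)
    simp only [zero_smul, add_zero, real_inner_self_eq_norm_sq]
    field_simp
    ring
  have hII : fderiv ℂ (fderiv ℂ Φ) z (I • u) (I • u) = -fderiv ℂ (fderiv ℂ Φ) z u u := by
    simp [smul_smul]
  rw [leviForm, hsnd, hsnd, hII]
  have hre : inner ℝ (Φ z) (I • fderiv ℂ Φ z u) = -(inner ℂ (Φ z) (fderiv ℂ Φ z u)).im := by
    rw [real_inner_eq_re_inner ℂ, inner_smul_right]
    simp
  have hre' : inner ℝ (Φ z) (fderiv ℂ Φ z u) = (inner ℂ (Φ z) (fderiv ℂ Φ z u)).re :=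
    real_inner_eq_re_inner ℂ _ _
  simp only [map_smul, inner_neg_right, norm_smul, norm_I, one_mul]
  have hnz := h0 z hz
  have hn0 : ‖Φ z‖ ≠ 0 := norm_ne_zero_iff.2 hnz
  rw [hre, hre', ← normSq_eq_norm_sq (inner ℂ _ _), normSq_apply]
  field_simp
  ring

end Levi

/-! ### The Bergman metric -/

section Metric

open MeasureTheory Complex Topology Filter

variable {n : ℕ} {D : Set (Fin n → ℂ)} {μ : (Fin n → ℝ) → ℝ}

/-- The potential `log K_D(z, z)` of the Bergman metric. -/
noncomputable def bergmanPotential (D : Set (Fin n → ℂ)) (μ : (Fin n → ℝ) → ℝ)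
    (w : Fin n → ℂ) : ℝ :=
  Real.log (bergmanKernel D μ w w).re

/-- Bounded holomorphic functions belong to the Bergman space, because `D` has finite weighted
volume. -/
theorem exists_conj_ae_eq (hD : IsBoundedLogConvexCompleteReinhardt D)
    (hμ : IsReinhardtWeight D μ) {f : (Fin n → ℂ) → ℂ} (hf : DifferentiableOn ℂ f D) {C : ℝ}
    (hC : ∀ z ∈ D, ‖f z‖ ≤ C) :
    ∃ F : Lp ℂ 2 (bergmanMeasure D μ), F =ᵐ[bergmanMeasure D μ] fun z => conj (f z) := by
  have hfin : IsFiniteMeasure (bergmanMeasure D μ) := hμ.isFiniteMeasure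
  have hm : AEStronglyMeasurable f (bergmanMeasure D μ) :=
    (hf.continuousOn.aestronglyMeasurable hD.isOpen.measurableSet).mono_ac
      bergmanMeasure_absolutelyContinuous
  have hL : MemLp f 2 (bergmanMeasure D μ) :=
    MemLp.of_bound hm C ((ae_bergmanMeasure_mem hD.isOpen).mono hC)
  exact ⟨hL.star.toLp, hL.star.coeFn_toLp⟩

/-- The potential is smooth and strictly plurisubharmonic. By the equality case of the
Cauchy-Schwarz inequality, degeneracy in the direction `u` would mean `∂_u f(z) = c f(z)` for all
`f` in the Bergman space, with `c` independent of `f`; the functions `1` and `z_k` exclude this. -/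
theorem bergmanPotential_smooth_and_pos (hD : IsBoundedLogConvexCompleteReinhardt D)
    (hμ : IsReinhardtWeight D μ) {z : Fin n → ℂ} (hz : z ∈ D) :
    ContDiffAt ℝ ∞ (bergmanPotential D μ) z ∧
      ∀ u, u ≠ 0 → 0 < leviForm (bergmanPotential D μ) z u u := by
  obtain ⟨V, hVo, hzV, -, Φ, hΦ, hrep, hK⟩ := exists_bergmanKernel_eq_norm_sq hD hμ hz
  obtain ⟨C, hC⟩ := hD.isBounded.exists_norm_le
  obtain ⟨F₁, hF₁⟩ := exists_conj_ae_eq hD hμ (f := fun _ => 1) (differentiableOn_const 1)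
    (C := 1) (fun z _ => by simp)
  have hrep₁ : ∀ w ∈ V, inner ℂ F₁ (Φ w) = 1 := fun w hw =>
    hrep w hw F₁ _ (differentiableOn_const 1) hF₁
  have h0 : ∀ w ∈ V, Φ w ≠ 0 := fun w hw h => by
    have := hrep₁ w hw
    rw [h, inner_zero_right] at this
    exact zero_ne_one this
  have hg : ∀ w ∈ V, bergmanPotential D μ w = Real.log (‖Φ w‖ ^ 2) := fun w hw => by
    obtain ⟨k, hk, hk'⟩ := hK w hw
    rw [bergmanPotential, hk.bergmanKernel_eq, hk', ofReal_re]
  refine ⟨(leviForm_log_norm_sq hVo hΦ h0 hg hzV 0).1, fun u hu => ?_⟩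
  rw [(leviForm_log_norm_sq hVo hΦ h0 hg hzV u).2]
  have hpos : 0 < ‖Φ z‖ := norm_pos_iff.2 (h0 z hzV)
  refine div_pos (sub_pos.2 ?_) (by positivity)
  rw [← mul_pow]
  refine pow_lt_pow_left₀ (lt_of_le_of_ne (norm_inner_le_norm _ _) fun heq => hu ?_)
    (norm_nonneg _) two_ne_zero
  have hd : HasFDerivAt Φ (fderiv ℂ Φ z) z :=
    ((hΦ.contDiffAt (hVo.mem_nhds hzV)).differentiableAt (by simp)).hasFDerivAt
  have hder : ∀ (F : Lp ℂ 2 (bergmanMeasure D μ)) (f : (Fin n → ℂ) → ℂ)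
      (f' : (Fin n → ℂ) →L[ℂ] ℂ), (∀ w ∈ V, inner ℂ F (Φ w) = f w) → HasFDerivAt f f' z →
      inner ℂ F (fderiv ℂ Φ z u) = f' u := by
    intro F f f' hFf hf
    have h1 : HasFDerivAt (fun w => inner ℂ F (Φ w)) ((innerSL ℂ F).comp (fderiv ℂ Φ z)) z :=
      (innerSL ℂ F).hasFDerivAt.comp z hd
    have h2 : (fun w => inner ℂ F (Φ w)) =ᶠ[𝓝 z] f := by
      filter_upwards [hVo.mem_nhds hzV] with w hw using hFf w hw
    exact congrArg (· u) ((h1.congr_of_eventuallyEq h2.symm).unique hf)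
  obtain ⟨c, hc⟩ : ∃ c : ℂ, fderiv ℂ Φ z u = c • Φ z := by
    have h : Φ z = 0 ∨ ∃ c : ℂ, fderiv ℂ Φ z u = c • Φ z :=
      ((norm_inner_eq_norm_tfae ℂ (Φ z) (fderiv ℂ Φ z u)).out 0 2).1 heq
    exact h.resolve_left (h0 z hzV)
  have hc0 : c = 0 := by
    have := hder F₁ (fun _ => 1) 0 hrep₁ (hasFDerivAt_const _ _)
    rwa [hc, inner_smul_right, hrep₁ z hzV, mul_one] at this
  ext k
  have hdk : DifferentiableOn ℂ (fun w : Fin n → ℂ => w k) D := by fun_prop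
  obtain ⟨F, hF⟩ := exists_conj_ae_eq hD hμ hdk
    (C := C) fun w hw => (norm_le_pi_norm w k).trans (hC w hw)
  have := hder F (fun w => w k) (ContinuousLinearMap.proj k)
    (fun w hw => hrep w hw F _ hdk hF) (hasFDerivAt_apply k z)
  rw [hc, hc0, zero_smul, inner_zero_right] at this
  exact this.symm

theorem contDiffAt_bergmanPotential (hD : IsBoundedLogConvexCompleteReinhardt D)
    (hμ : IsReinhardtWeight D μ) {z : Fin n → ℂ} (hz : z ∈ D) :
    ContDiffAt ℝ ∞ (bergmanPotential D μ) z :=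
  (bergmanPotential_smooth_and_pos hD hμ hz).1

theorem bergmanMetric_eq_leviForm (hD : IsBoundedLogConvexCompleteReinhardt D)
    (hμ : IsReinhardtWeight D μ) {z : Fin n → ℂ} (hz : z ∈ D) (u v : Fin n → ℂ) :
    bergmanMetric D μ z u v = leviForm (bergmanPotential D μ) z u v := by
  have h2 : ContDiffAt ℝ 2 (bergmanPotential D μ) z :=
    (contDiffAt_bergmanPotential hD hμ hz).of_le (by norm_cast)
  rw [← re_complexLeviForm, ← sum_complexLeviForm]
  simp only [← dz_dzbar_ofReal h2]
  rfl

theorem isRiemannianMetricOn_bergmanMetric (hD : IsBoundedLogConvexCompleteReinhardt D)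
    (hμ : IsReinhardtWeight D μ) : IsRiemannianMetricOn D (bergmanMetric D μ) where
  smooth u v := by
    have h : ContDiffOn ℝ ∞ (fun z => leviForm (bergmanPotential D μ) z u v) D := fun z hz => by
      have h2 : ContDiffAt ℝ ∞ (fderiv ℝ (fderiv ℝ (bergmanPotential D μ))) z :=
        ((contDiffAt_bergmanPotential hD hμ hz).fderiv_right (m := ∞) (by norm_cast)).fderiv_right
          (m := ∞) (by norm_cast)
      have h3 : ∀ u v, ContDiffAt ℝ ∞
          (fun z => fderiv ℝ (fderiv ℝ (bergmanPotential D μ)) z u v) z := fun u v =>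
        (h2.clm_apply contDiffAt_const).clm_apply contDiffAt_const
      exact (((h3 u v).add (h3 _ _)).div_const 4).contDiffWithinAt
    exact h.congr fun z hz => bergmanMetric_eq_leviForm hD hμ hz u v
  symm z hz u v := by
    have hs : IsSymmSndFDerivAt ℝ (bergmanPotential D μ) z :=
      (contDiffAt_bergmanPotential hD hμ hz).isSymmSndFDerivAt
        (by rw [minSmoothness_of_isRCLikeNormedField]; norm_cast)
    rw [bergmanMetric_eq_leviForm hD hμ hz, bergmanMetric_eq_leviForm hD hμ hz, leviForm, leviForm,
      hs.eq u v, hs.eq (I • u)]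
  pos z hz u hu := by
    rw [bergmanMetric_eq_leviForm hD hμ hz]
    exact (bergmanPotential_smooth_and_pos hD hμ hz).2 u hu

theorem bergmanMetric_comp (hD : IsBoundedLogConvexCompleteReinhardt D)
    (hμ : IsReinhardtWeight D μ) (L : (Fin n → ℂ) →L[ℝ] (Fin n → ℂ))
    (hmod : ∀ w, moduli (L w) = moduli w)
    (hL : (∀ u, L (I • u) = I • L u) ∨ ∀ u, L (I • u) = -(I • L u)) {z : Fin n → ℂ} (hz : z ∈ D)
    (u v : Fin n → ℂ) :
    bergmanMetric D μ (L z) (L u) (L v) = bergmanMetric D μ z u v := by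
  have hLz : L z ∈ D := (hD.mem_iff_of_moduli_eq (hmod z)).2 hz
  rw [bergmanMetric_eq_leviForm hD hμ hz, bergmanMetric_eq_leviForm hD hμ hLz]
  refine leviForm_comp L ((contDiffAt_bergmanPotential hD hμ hz).of_le (by norm_cast))
    ((contDiffAt_bergmanPotential hD hμ hLz).of_le (by norm_cast)) ?_ hL u v
  filter_upwards [hD.isOpen.mem_nhds hz] with w hw
  rw [bergmanPotential, bergmanKernel_eq_of_moduli_eq hD hμ hw (hmod w), bergmanPotential]

/-- The action of an angle vector as a real linear map. -/
noncomputable def torusCLM (θ : Fin n → ℝ) : (Fin n → ℂ) →L[ℝ] (Fin n → ℂ) :=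
  ContinuousLinearMap.pi fun k =>
    ((exp (θ k * I) • ContinuousLinearMap.proj k : (Fin n → ℂ) →L[ℂ] ℂ)).restrictScalars ℝ

theorem torusCLM_apply (θ : Fin n → ℝ) (z : Fin n → ℂ) : torusCLM θ z = torusAct θ z := rfl

theorem bergmanMetric_torusAct (hD : IsBoundedLogConvexCompleteReinhardt D)
    (hμ : IsReinhardtWeight D μ) (θ : Fin n → ℝ) {z : Fin n → ℂ} (hz : z ∈ D)
    (u v : Fin n → ℂ) :
    bergmanMetric D μ (torusAct θ z) (torusAct θ u) (torusAct θ v) = bergmanMetric D μ z u v :=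
  bergmanMetric_comp hD hμ (torusCLM θ) (moduli_torusAct θ)
    (Or.inl fun u => funext fun k => by simp [torusCLM_apply, torusAct]; ring) hz u v

/-- The real linear reflection `w_k ↦ (z_k / z̄_k) w̄_k`, which fixes `z`. -/
noncomputable def reflectionCLM (z : Fin n → ℂ) : (Fin n → ℂ) →L[ℝ] (Fin n → ℂ) :=
  ContinuousLinearMap.pi fun k => (z k / conj (z k)) •
    (conjCLE.toContinuousLinearMap.comp (ContinuousLinearMap.proj k : (Fin n → ℂ) →L[ℝ] ℂ))

theorem reflectionCLM_apply (z w : Fin n → ℂ) (k : Fin n) :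
    reflectionCLM z w k = z k / conj (z k) * conj (w k) := by
  simp [reflectionCLM]

/-- At `z`, the radial vectors `(a_k z_k)` and the angular vectors `(i b_k z_k)` are orthogonal:
the reflection fixing `z` preserves the former and reverses the latter. -/
theorem bergmanMetric_radial_angular (hD : IsBoundedLogConvexCompleteReinhardt D)
    (hμ : IsReinhardtWeight D μ) {z : Fin n → ℂ} (hz : z ∈ puncturedPart D) (a b : Fin n → ℝ) :
    bergmanMetric D μ z (fun k => a k * z k) (fun k => b k * (I * z k)) = 0 := by
  have hc : ∀ k, conj (z k) ≠ 0 := fun k => (map_ne_zero _).2 (hz.2 k)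
  have hmod : ∀ w, moduli (reflectionCLM z w) = moduli w := fun w => funext fun k => by
    simp [moduli, reflectionCLM_apply, hz.2 k]
  have h := bergmanMetric_comp hD hμ (reflectionCLM z) hmod
    (Or.inr fun u => funext fun k => by simp [reflectionCLM_apply]; ring) hz.1
    (fun k => a k * z k) (fun k => b k * (I * z k))
  have h1 : reflectionCLM z z = z := funext fun k => by
    rw [reflectionCLM_apply]; field_simp [hc k]
  have h2 : reflectionCLM z (fun k => a k * z k) = fun k => a k * z k := funext fun k => by
    rw [reflectionCLM_apply, map_mul, conj_ofReal]; field_simp [hc k]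
  have h3 : reflectionCLM z (fun k => b k * (I * z k)) = -fun k => b k * (I * z k) :=
    funext fun k => by
      simp only [reflectionCLM_apply, map_mul, conj_ofReal, conj_I, Pi.neg_apply]
      field_simp [hc k]
  rw [h1, h2, h3, map_neg] at h
  linarith

end Metric

/-! ### The foliation by torus orbits -/

section TorusFoliation

open Complex Topology

variable {n : ℕ} {D : Set (Fin n → ℂ)}

theorem isOpen_puncturedPart (hD : IsOpen D) : IsOpen (puncturedPart D) := by
  have : puncturedPart D = D ∩ ⋂ k, {z | z k ≠ 0} := by
    ext z; simp [puncturedPart]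
  rw [this]
  exact hD.inter (isOpen_iInter_of_finite fun k =>
    isOpen_ne_fun (continuous_apply k) continuous_const)

theorem volume_diff_puncturedPart (D : Set (Fin n → ℂ)) :
    MeasureTheory.volume (D \ puncturedPart D) = 0 := by
  refine MeasureTheory.measure_mono_null (t := ⋃ k, {z : Fin n → ℂ | z k = 0}) ?_ ?_
  · intro z hz
    by_contra h
    exact hz.2 ⟨hz.1, by simpa using h⟩
  · exact MeasureTheory.measure_iUnion_null fun k =>
      MeasureTheory.Measure.pi_hyperplane 
        (fun _ : Fin n => (MeasureTheory.volume : MeasureTheory.Measure ℂ)) k 0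

theorem mem_torusOrbit_iff {z w : Fin n → ℂ} : w ∈ torusOrbit z ↔ moduli w = moduli z := by
  constructor
  · rintro ⟨t, rfl⟩
    ext k
    change ‖(t k : ℂ) * z k‖ = ‖z k‖
    rw [norm_mul, Circle.norm_coe, one_mul]
  · intro h
    obtain ⟨θ, rfl⟩ := torus_transitive h
    exact ⟨fun k => Circle.exp (θ k), funext fun k => by simp [torusAct]⟩

theorem torusOrbit_eq_range (z : Fin n → ℂ) :
    torusOrbit z = Set.range fun θ : Fin n → ℝ => torusAct θ z := by
  ext w
  rw [mem_torusOrbit_iff]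
  constructor
  · intro h
    obtain ⟨θ, rfl⟩ := torus_transitive h
    exact ⟨θ, rfl⟩
  · rintro ⟨θ, rfl⟩
    exact moduli_torusAct θ z

theorem isPreconnected_torusOrbit (z : Fin n → ℂ) : IsPreconnected (torusOrbit z) := by
  rw [torusOrbit_eq_range]
  exact isPreconnected_range (continuous_torusAct.comp (by fun_prop : Continuous fun θ => (θ, z)))

theorem mem_puncturedPart_of_moduli_eq (hD : IsBoundedLogConvexCompleteReinhardt D)
    {z w : Fin n → ℂ} (h : moduli w = moduli z) (hz : z ∈ puncturedPart D) :
    w ∈ puncturedPart D :=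
  ⟨(hD.mem_iff_of_moduli_eq h).2 hz.1, fun k => by
    rw [← norm_ne_zero_iff, show ‖w k‖ = ‖z k‖ from congrFun h k]
    exact norm_ne_zero_iff.2 (hz.2 k)⟩

/-- The vector `(log |z_1|, …, log |z_n|)`. -/
noncomputable def logModuli (z : Fin n → ℂ) : EuclideanSpace ℝ (Fin n) :=
  WithLp.toLp 2 fun k => Real.log ‖z k‖

/-- The logarithmic real parts `(Re (v_k / z_k))_k` of a tangent vector `v` at `z`. -/
noncomputable def logModuliDeriv (z : Fin n → ℂ) :
    (Fin n → ℂ) →L[ℝ] EuclideanSpace ℝ (Fin n) :=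
  (EuclideanSpace.equiv (Fin n) ℝ).symm.toContinuousLinearMap.comp
    (ContinuousLinearMap.pi fun k => reCLM.comp
      (((z k)⁻¹ • ContinuousLinearMap.proj k : (Fin n → ℂ) →L[ℂ] ℂ).restrictScalars ℝ))

@[simp]
theorem logModuliDeriv_apply (z v : Fin n → ℂ) (k : Fin n) :
    logModuliDeriv z v k = (v k / z k).re := by
  simp [logModuliDeriv, div_eq_inv_mul]

theorem hasFDerivAt_logModuli {z : Fin n → ℂ} (hz : ∀ k, z k ≠ 0) :
    HasFDerivAt logModuli (logModuliDeriv z) z := by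
  refine (EuclideanSpace.equiv (Fin n) ℝ).symm.toContinuousLinearMap.hasFDerivAt.comp
    (f := fun z k => Real.log ‖z k‖) z (hasFDerivAt_pi.2 fun k => ?_)
  have h1 : HasFDerivAt (fun w : Fin n → ℂ => w k) (ContinuousLinearMap.proj (R := ℝ) k) z :=
    hasFDerivAt_apply k z
  have h2 := (h1.norm_sq.log (pow_ne_zero 2 (norm_ne_zero_iff.2 (hz k)))).const_mul (1 / 2)
  have h3 : (fun w : Fin n → ℂ => Real.log ‖w k‖)
      = fun w => 1 / 2 * Real.log (‖w k‖ ^ 2) := by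
    ext w
    rw [Real.log_pow]
    push_cast
    ring
  rw [h3]
  refine h2.congr_fderiv (ContinuousLinearMap.ext fun v => ?_)
  have h4 : normSq (z k) ≠ 0 := by simpa using hz k
  simp only [_root_.smul_apply, ContinuousLinearMap.comp_apply,
    innerSL_apply_apply, ContinuousLinearMap.proj_apply, Complex.inner, reCLM_apply, smul_eq_mul,
    ContinuousLinearMap.coe_restrictScalars', ← normSq_eq_norm_sq]
  simp only [mul_re, inv_re, inv_im, conj_re, conj_im, nsmul_eq_mul]
  field_simp
  push_cast
  ring

theorem contDiffAt_logModuli {z : Fin n → ℂ} (hz : ∀ k, z k ≠ 0) :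
    ContDiffAt ℝ ∞ logModuli z := by
  refine (EuclideanSpace.equiv (Fin n) ℝ).symm.toContinuousLinearMap.contDiff.contDiffAt.comp
    (f := fun z k => Real.log ‖z k‖) z (contDiffAt_pi.2 fun k => ?_)
  exact (((contDiff_apply ℝ ℂ k).contDiffAt).norm ℝ (hz k)).log (norm_ne_zero_iff.2 (hz k))

/-- The radial vector `(a_k z_k)_k` at `z`. -/
def radial (z : Fin n → ℂ) (a : Fin n → ℝ) : Fin n → ℂ := fun k => a k * z k

theorem logModuliDeriv_radial {z : Fin n → ℂ} (hz : ∀ k, z k ≠ 0) (a : Fin n → ℝ) :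
    logModuliDeriv z (radial z a) = WithLp.toLp 2 a := by
  ext k
  simp [radial, hz k]

theorem torusAct_radial (θ : Fin n → ℝ) (z : Fin n → ℂ) (a : Fin n → ℝ) :
    torusAct θ (radial z a) = radial (torusAct θ z) a := by
  ext k
  simp [torusAct, radial]
  ring

/-- The global chart `z ↦ (log |z_k|)_k`, whose fibres are the torus orbits. -/
noncomputable def logModuliChart (hD : IsOpen D) : FoliatedChart (puncturedPart D) n where
  domain := puncturedPart D
  target := Set.univ
  toFun := logModuli
  isOpen_domain := isOpen_puncturedPart hD
  isOpen_target := isOpen_univ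
  domain_subset := Set.Subset.rfl
  mapsTo := Set.mapsTo_univ _ _
  smooth := fun z hz => (contDiffAt_logModuli hz.2).contDiffWithinAt
  submersion := fun z hz a => by
    rw [(hasFDerivAt_logModuli hz.2).fderiv]
    exact ⟨radial z a, logModuliDeriv_radial hz.2 a⟩

/-- The foliation of the punctured domain by the torus orbits. -/
noncomputable def torusFoliation (hD : IsOpen D) : Foliation (puncturedPart D) n where
  charts := {logModuliChart hD}
  compatible := by
    rintro c rfl c' rfl
    exact ⟨id, id, contDiffOn_id, contDiffOn_id, fun x _ => ⟨rfl, rfl⟩⟩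
  cover := by simp [logModuliChart]

theorem logModuli_eq_iff {z w : Fin n → ℂ} (hz : ∀ k, z k ≠ 0) (hw : ∀ k, w k ≠ 0) :
    logModuli w = logModuli z ↔ moduli w = moduli z := by
  constructor
  · intro h
    ext k
    exact Real.log_injOn_pos (norm_pos_iff.2 (hw k)) (norm_pos_iff.2 (hz k))
      (congrFun (congrArg WithLp.ofLp h) k)
  · intro h
    ext k
    exact congrArg Real.log (congrFun h k)

theorem fiber_logModuliChart (hD : IsBoundedLogConvexCompleteReinhardt D) {z : Fin n → ℂ}
    (hz : z ∈ puncturedPart D) : (logModuliChart hD.isOpen).fiber z = torusOrbit z := by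
  ext w
  rw [mem_torusOrbit_iff]
  constructor
  · rintro ⟨hw, h⟩
    exact (logModuli_eq_iff hz.2 hw.2).1 h
  · intro h
    have hw := mem_puncturedPart_of_moduli_eq hD h hz
    exact ⟨hw, (logModuli_eq_iff hz.2 hw.2).2 h⟩

theorem rel_torusFoliation_iff (hD : IsBoundedLogConvexCompleteReinhardt D) {z w : Fin n → ℂ}
    (hz : z ∈ puncturedPart D) : (torusFoliation hD.isOpen).Rel z w ↔ moduli w = moduli z := by
  have hplaque : ∀ x ∈ puncturedPart D,
      connectedComponentIn ((logModuliChart hD.isOpen).fiber x) x = torusOrbit x := fun x hx => by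
    rw [fiber_logModuliChart hD hx]
    exact (isPreconnected_torusOrbit x).connectedComponentIn (mem_torusOrbit_iff.2 rfl)
  constructor
  · have hstep : ∀ x y, (∃ c ∈ (torusFoliation hD.isOpen).charts,
        ∃ P, c.IsPlaque P ∧ x ∈ P ∧ y ∈ P) → moduli y = moduli x := by
      rintro x y ⟨c, rfl, P, ⟨p, hp, rfl⟩, hx, hy⟩
      rw [hplaque p hp, mem_torusOrbit_iff] at hx hy
      rw [hx, hy]
    intro h
    induction h with
    | single h => exact hstep _ _ h
    | tail _ h ih => exact (hstep _ _ h).trans ih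
  · intro h
    refine Relation.TransGen.single ⟨_, rfl, torusOrbit z, ⟨z, hz, (hplaque z hz).symm⟩, ?_, ?_⟩
    · exact mem_torusOrbit_iff.2 rfl
    · exact mem_torusOrbit_iff.2 h

theorem leaves_torusFoliation (hD : IsBoundedLogConvexCompleteReinhardt D) :
    (torusFoliation hD.isOpen).leaves = torusOrbit '' puncturedPart D := by
  have : ∀ z ∈ puncturedPart D, {w | (torusFoliation hD.isOpen).Rel z w} = torusOrbit z :=
    fun z hz => Set.ext fun w => (rel_torusFoliation_iff hD hz).trans mem_torusOrbit_iff.symm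
  ext L
  constructor
  · rintro ⟨z, hz, rfl⟩
    exact ⟨z, hz, (this z hz).symm⟩
  · rintro ⟨z, hz, rfl⟩
    exact ⟨z, hz, (this z hz).symm⟩

theorem tangent_torusFoliation (hD : IsOpen D) {z : Fin n → ℂ} (hz : z ∈ puncturedPart D) :
    (torusFoliation hD).tangent z = (logModuliDeriv z).toLinearMap.ker := by
  have h : fderiv ℝ (logModuliChart hD).toFun z = logModuliDeriv z :=
    (hasFDerivAt_logModuli hz.2).fderiv
  have hz' : z ∈ (logModuliChart hD).domain := hz
  simp [Foliation.tangent, torusFoliation, h, hz']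

theorem mem_tangent_torusFoliation (hD : IsOpen D) {z : Fin n → ℂ} (hz : z ∈ puncturedPart D)
    (v : Fin n → ℂ) : v ∈ (torusFoliation hD).tangent z ↔ ∀ k, (v k / z k).re = 0 := by
  rw [tangent_torusFoliation hD hz, LinearMap.mem_ker]
  constructor
  · intro h k
    rw [← logModuliDeriv_apply]
    exact congrFun (congrArg WithLp.ofLp h) k
  · intro h
    ext k
    simpa using h k

theorem sub_radial_mem_tangent (hD : IsOpen D) {z : Fin n → ℂ} (hz : z ∈ puncturedPart D)
    (v : Fin n → ℂ) :
    v - radial z (logModuliDeriv z v) ∈ (torusFoliation hD).tangent z := by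
  rw [tangent_torusFoliation hD hz, LinearMap.mem_ker]
  change logModuliDeriv z _ = 0
  rw [map_sub, logModuliDeriv_radial hz.2]
  simp

theorem mkQ_radial_logModuliDeriv (hD : IsOpen D) {z : Fin n → ℂ} (hz : z ∈ puncturedPart D)
    (v : Fin n → ℂ) : ((torusFoliation hD).tangent z).mkQ (radial z (logModuliDeriv z v))
      = ((torusFoliation hD).tangent z).mkQ v :=
  ((Submodule.Quotient.eq _).2 (sub_radial_mem_tangent hD hz v)).symm

/-- The vectors perpendicular to the torus orbit of `z` are the radial ones. -/
theorem perp_torusFoliation_iff (hD : IsBoundedLogConvexCompleteReinhardt D)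
    {μ : (Fin n → ℝ) → ℝ} (hμ : IsReinhardtWeight D μ) {z : Fin n → ℂ}
    (hz : z ∈ puncturedPart D) (v : Fin n → ℂ) :
    (torusFoliation hD.isOpen).Perp (bergmanMetric D μ) z v
      ↔ v = radial z (logModuliDeriv z v) := by
  have hang : ∀ w ∈ (torusFoliation hD.isOpen).tangent z,
      w = fun k => ((w k / z k).im : ℂ) * (I * z k) := by
    intro w hw
    ext k
    have h1 := (mem_tangent_torusFoliation hD.isOpen hz w).1 hw k
    have h2 : w k / z k = (w k / z k).im * I := by
      apply Complex.ext <;> simp [h1]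
    rw [← mul_assoc, ← h2, div_mul_cancel₀ _ (hz.2 k)]
  have horth : ∀ a, ∀ w ∈ (torusFoliation hD.isOpen).tangent z,
      bergmanMetric D μ z (radial z a) w = 0 := by
    intro a w hw
    rw [hang w hw]
    exact bergmanMetric_radial_angular hD hμ hz a _
  constructor
  · intro h
    -- The angular part of `v` is orthogonal to `v` and to the radial part, hence to itself.
    by_contra hne
    have hmem := sub_radial_mem_tangent hD.isOpen hz v
    have h1 := h _ hmem
    have h2 := (isRiemannianMetricOn_bergmanMetric hD hμ).pos z hz.1 _ (sub_ne_zero.2 hne)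
    rw [LinearMap.map_sub₂, h1, horth _ _ hmem, sub_zero] at h2
    exact lt_irrefl _ h2
  · intro h w hw
    rw [h]
    exact horth _ w hw

theorem perp_radial (hD : IsBoundedLogConvexCompleteReinhardt D)
    {μ : (Fin n → ℝ) → ℝ} (hμ : IsReinhardtWeight D μ) {z : Fin n → ℂ}
    (hz : z ∈ puncturedPart D) (a : Fin n → ℝ) :
    (torusFoliation hD.isOpen).Perp (bergmanMetric D μ) z (radial z a) := by
  rw [perp_torusFoliation_iff hD hμ hz, logModuliDeriv_radial hz.2]

theorem bergmanMetric_radial_torusAct (hD : IsBoundedLogConvexCompleteReinhardt D)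
    {μ : (Fin n → ℝ) → ℝ} (hμ : IsReinhardtWeight D μ) {z : Fin n → ℂ} (hz : z ∈ D)
    (θ : Fin n → ℝ) (a b : Fin n → ℝ) :
    bergmanMetric D μ (torusAct θ z) (radial (torusAct θ z) a) (radial (torusAct θ z) b)
      = bergmanMetric D μ z (radial z a) (radial z b) := by
  rw [← torusAct_radial, ← torusAct_radial, bergmanMetric_torusAct hD hμ θ hz]

end TorusFoliation

/-! ### A smooth Cholesky decomposition -/

section Cholesky

variable {X : Type*} [NormedAddCommGroup X] [NormedSpace ℝ X]

/-- A smooth family of positive definite matrices `Q` has a smooth family of factors `S` with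
`SᵀS = Q`. The first row of `S` is `Q_{0j} / √Q_{00}`, and the other rows factor the Schur
complement of `Q_{00}`. -/
theorem exists_contDiffOn_cholesky {U : Set X} {n : ℕ} (Q : X → Fin n → Fin n → ℝ)
    (hQ : ∀ i j, ContDiffOn ℝ ∞ (fun x => Q x i j) U)
    (hsymm : ∀ x ∈ U, ∀ i j, Q x i j = Q x j i)
    (hpos : ∀ x ∈ U, ∀ a : Fin n → ℝ, a ≠ 0 → 0 < ∑ i, ∑ j, a i * a j * Q x i j) :
    ∃ S : X → Fin n → Fin n → ℝ, (∀ i j, ContDiffOn ℝ ∞ (fun x => S x i j) U) ∧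
      ∀ x ∈ U, ∀ i j, ∑ k, S x k i * S x k j = Q x i j := by
  induction n with
  | zero => exact ⟨Q, hQ, fun x _ i => i.elim0⟩
  | succ n ih =>
    have h00 : ∀ x ∈ U, 0 < Q x 0 0 := fun x hx => by
      have := hpos x hx (Pi.single 0 1) (by simp)
      simpa [Fin.sum_univ_succ, Pi.single_apply] using this
    obtain ⟨S, hS, hSQ⟩ := ih
      (fun x i j => Q x i.succ j.succ - Q x 0 i.succ * Q x 0 j.succ / Q x 0 0)
      (fun i j => (hQ _ _).sub (((hQ _ _).mul (hQ _ _)).div (hQ _ _) fun x hx => (h00 x hx).ne'))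
      (fun x hx i j => by rw [hsymm x hx i.succ, mul_comm (Q x 0 i.succ)])
      (fun x hx a ha => by
        -- Completing the square: the value of `Q` at the vector `a` extended by `t`.
        set t : ℝ := -(∑ i, a i * Q x 0 i.succ) / Q x 0 0 with ht
        have h := hpos x hx (Fin.cons t a) fun h0 => ha (funext fun i => by
          simpa using congrFun h0 i.succ)
        refine h.trans_eq ?_
        have h0 := (h00 x hx).ne'
        have e1 : ∑ i, ∑ j, a i * a j * (Q x i.succ j.succ - Q x 0 i.succ * Q x 0 j.succ / Q x 0 0)
            = ∑ i, ∑ j, a i * a j * Q x i.succ j.succ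
              - (∑ i, a i * Q x 0 i.succ) * (∑ i, a i * Q x 0 i.succ) / Q x 0 0 := by
          rw [Finset.sum_mul_sum, Finset.sum_div, ← Finset.sum_sub_distrib]
          refine Finset.sum_congr rfl fun i _ => ?_
          rw [Finset.sum_div, ← Finset.sum_sub_distrib]
          exact Finset.sum_congr rfl fun j _ => by ring
        have e2 : ∑ i : Fin n, a i * t * Q x i.succ 0 = t * ∑ i, a i * Q x 0 i.succ := by
          rw [Finset.mul_sum]
          exact Finset.sum_congr rfl fun i _ => by rw [hsymm x hx i.succ 0]; ring
        have e3 : ∑ i : Fin n, t * a i * Q x 0 i.succ = t * ∑ i, a i * Q x 0 i.succ := by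
          rw [Finset.mul_sum]
          exact Finset.sum_congr rfl fun i _ => by ring
        simp only [Fin.sum_univ_succ, Fin.cons_zero, Fin.cons_succ, Finset.sum_add_distrib, e1, e2,
          e3]
        rw [ht]
        field_simp
        ring)
    refine ⟨fun x => Fin.cons (fun j => Q x 0 j / Real.sqrt (Q x 0 0))
      fun k => Fin.cons 0 fun j => S x k j, ?_, ?_⟩
    · refine Fin.cases (fun j => ?_) fun k => Fin.cases ?_ fun j => ?_
      · simp only [Fin.cons_zero]
        exact (hQ 0 j).div ((hQ 0 0).sqrt fun x hx => (h00 x hx).ne')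
          fun x hx => (Real.sqrt_pos.2 (h00 x hx)).ne'
      · simpa only [Fin.cons_succ, Fin.cons_zero] using contDiffOn_const
      · simpa only [Fin.cons_succ] using hS k j
    · intro x hx
      have h0 := (h00 x hx).ne'
      have hs : ∀ a b : ℝ, a / Real.sqrt (Q x 0 0) * (b / Real.sqrt (Q x 0 0))
          = a * b / Q x 0 0 := fun a b => by
        rw [div_mul_div_comm, Real.mul_self_sqrt (h00 x hx).le]
      refine Fin.cases (Fin.cases ?_ fun j => ?_) fun i => Fin.cases ?_ fun j => ?_
      all_goals simp only [Fin.sum_univ_succ, Fin.cons_zero, Fin.cons_succ, hs]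
      · simp [h0]
      · simp [h0]
      · simp [h0, hsymm x hx i.succ 0]
      · simp [hSQ x hx i j]

end Cholesky

/-! ### The transverse Riemannian structure -/

section Transverse

open Complex Topology

variable {n : ℕ} {D : Set (Fin n → ℂ)} {μ : (Fin n → ℝ) → ℝ}

/-- Since the perpendicular vectors are the radial ones, a transverse frame is orthonormal if it
is isometric on radial vectors. -/
theorem mem_orthonormalFrames_iff (hD : IsBoundedLogConvexCompleteReinhardt D)
    (hμ : IsReinhardtWeight D μ) (f : (torusFoliation hD.isOpen).TransverseFrame) :
    f ∈ (torusFoliation hD.isOpen).orthonormalFrames (bergmanMetric D μ) ↔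
      ∀ a b : Fin n → ℝ,
        inner ℝ (f.frame.symm (((torusFoliation hD.isOpen).tangent f.pt).mkQ (radial f.pt a)))
          (f.frame.symm (((torusFoliation hD.isOpen).tangent f.pt).mkQ (radial f.pt b)))
          = bergmanMetric D μ f.pt (radial f.pt a) (radial f.pt b) := by
  constructor
  · intro h a b
    exact h _ _ (perp_radial hD hμ f.mem a) (perp_radial hD hμ f.mem b)
  · intro h v w hv hw
    rw [(perp_torusFoliation_iff hD hμ f.mem v).1 hv, (perp_torusFoliation_iff hD hμ f.mem w).1 hw]
    exact h _ _

theorem norm_sq_frame_symm (hD : IsBoundedLogConvexCompleteReinhardt D)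
    (hμ : IsReinhardtWeight D μ) {f : (torusFoliation hD.isOpen).TransverseFrame}
    (hf : f ∈ (torusFoliation hD.isOpen).orthonormalFrames (bergmanMetric D μ))
    (v : Fin n → ℂ) :
    ‖f.frame.symm (((torusFoliation hD.isOpen).tangent f.pt).mkQ v)‖ ^ 2
      = bergmanMetric D μ f.pt (radial f.pt (logModuliDeriv f.pt v))
        (radial f.pt (logModuliDeriv f.pt v)) := by
  rw [← mkQ_radial_logModuliDeriv hD.isOpen f.mem v, ← real_inner_self_eq_norm_sq]
  exact (mem_orthonormalFrames_iff hD hμ f).1 hf _ _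

/-- A vector of the transverse space is determined by its image under the differential of the
chart. -/
theorem eq_mkQ_radial_of_liftQ_eq (hD : IsOpen D) {z : Fin n → ℂ} (hz : z ∈ puncturedPart D)
    {A : (Fin n → ℂ) →ₗ[ℝ] EuclideanSpace ℝ (Fin n)} (hA : A = (logModuliDeriv z).toLinearMap)
    (hle : (torusFoliation hD).tangent z ≤ A.ker) {q : (Fin n → ℂ) ⧸ (torusFoliation hD).tangent z}
    {a : Fin n → ℝ} (hq : ((torusFoliation hD).tangent z).liftQ A hle q = WithLp.toLp 2 a) :
    q = ((torusFoliation hD).tangent z).mkQ (radial z a) := by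
  obtain ⟨v, rfl⟩ := Submodule.mkQ_surjective _ q
  rw [Submodule.mkQ_apply, Submodule.liftQ_apply, hA] at hq
  have hq' : logModuliDeriv z v = WithLp.toLp 2 a := hq
  rw [← mkQ_radial_logModuliDeriv hD hz v, hq']

theorem isSaturated_orthonormalFrames (hD : IsBoundedLogConvexCompleteReinhardt D)
    (hμ : IsReinhardtWeight D μ) :
    (torusFoliation hD.isOpen).IsSaturated
      ((torusFoliation hD.isOpen).orthonormalFrames (bergmanMetric D μ)) := by
  have hstep : ∀ f g : (torusFoliation hD.isOpen).TransverseFrame,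
      (∃ P, (torusFoliation hD.isOpen).IsLiftedPlaque P ∧ f ∈ P ∧ g ∈ P) →
      f ∈ (torusFoliation hD.isOpen).orthonormalFrames (bergmanMetric D μ) →
      g ∈ (torusFoliation hD.isOpen).orthonormalFrames (bergmanMetric D μ) := by
    rintro f g ⟨P, ⟨c, hc, f₀, hf₀, rfl⟩, hf, hg⟩ hQ
    obtain ⟨hf', hfe⟩ := connectedComponentIn_subset _ _ hf
    obtain ⟨hg', hge⟩ := connectedComponentIn_subset _ _ hg
    have hc' : c = logModuliChart hD.isOpen := hc
    subst hc'
    have he := hge.trans hfe.symm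
    have hpt : logModuli g.pt = logModuli f.pt := congrArg Prod.fst he
    have hfr := congrArg Prod.snd he
    simp only [Foliation.liftedChart] at hfr
    have hmod := (logModuli_eq_iff f.mem.2 g.mem.2).1 hpt
    obtain ⟨θ, hθ⟩ := torus_transitive hmod
    have hderiv : ∀ z ∈ puncturedPart D,
        (fderiv ℝ (logModuliChart hD.isOpen).toFun z).toLinearMap
          = (logModuliDeriv z).toLinearMap := fun z hz =>
      congrArg _ (hasFDerivAt_logModuli hz.2).fderiv
    -- Both frames assign the same coordinates to the radial vector with components `a`.
    have hsymm : ∀ a : Fin n → ℝ,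
        g.frame.symm (((torusFoliation hD.isOpen).tangent g.pt).mkQ (radial g.pt a))
          = f.frame.symm (((torusFoliation hD.isOpen).tangent f.pt).mkQ (radial f.pt a)) := by
      intro a
      rw [LinearEquiv.symm_apply_eq]
      refine (eq_mkQ_radial_of_liftQ_eq hD.isOpen g.mem (hderiv _ g.mem)
        (Foliation.tangent_le_ker _ hc hg') ?_).symm
      refine (LinearMap.congr_fun hfr _).trans ?_
      rw [LinearMap.comp_apply, LinearEquiv.coe_coe, LinearEquiv.apply_symm_apply,
        Submodule.mkQ_apply, Submodule.liftQ_apply, hderiv _ f.mem]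
      exact logModuliDeriv_radial f.mem.2 a
    rw [mem_orthonormalFrames_iff hD hμ] at hQ ⊢
    intro a b
    rw [hsymm, hsymm, hQ, hθ, bergmanMetric_radial_torusAct hD hμ f.mem.1]
  intro f hf g hfg
  induction hfg with
  | single h => exact hstep _ _ h hf
  | tail _ h ih => exact hstep _ _ h ih

/-- The transverse frame whose coframe is a given surjection with the tangent space of the leaf
as its kernel. -/
noncomputable def frameOfCoframe {E : Type*} [NormedAddCommGroup E] [NormedSpace ℝ E] {M : Set E}
    {q : ℕ} (F : Foliation M q) (z : E) (hz : z ∈ M) (A : E →ₗ[ℝ] EuclideanSpace ℝ (Fin q))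
    (hker : F.tangent z = A.ker) (hA : Function.Surjective A) : F.TransverseFrame where
  pt := z
  frame := ((Submodule.quotEquivOfEq _ _ hker).trans (A.quotKerEquivOfSurjective hA)).symm
  mem := hz

theorem radial_eq_sum (z : Fin n → ℂ) (a : Fin n → ℝ) :
    radial z a = ∑ i, a i • Pi.single i (z i) := by
  ext k
  simp [radial, Finset.sum_apply, Pi.single_apply]

theorem bergmanMetric_radial_eq_sum (z : Fin n → ℂ) (a b : Fin n → ℝ) :
    bergmanMetric D μ z (radial z a) (radial z b)
      = ∑ i, ∑ j, a i * b j * bergmanMetric D μ z (Pi.single i (z i)) (Pi.single j (z j)) := by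
  rw [Finset.sum_comm]
  simp only [radial_eq_sum, map_sum, LinearMap.sum_apply, map_smul, LinearMap.smul_apply,
    smul_eq_mul]
  refine Finset.sum_congr rfl fun j _ => ?_
  rw [Finset.mul_sum]
  exact Finset.sum_congr rfl fun i _ => by ring

theorem contDiffOn_bergmanMetric_apply (hD : IsBoundedLogConvexCompleteReinhardt D)
    (hμ : IsReinhardtWeight D μ) (i j : Fin n) :
    ContDiffOn ℝ ∞ (fun z => bergmanMetric D μ z (Pi.single i (z i)) (Pi.single j (z j))) D := by
  have hs : ∀ (i : Fin n) (c : ℂ),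
      (Pi.single i c : Fin n → ℂ)
      = c.re • (Pi.single i 1 : Fin n → ℂ) + c.im • (Pi.single i I : Fin n → ℂ) := fun i c => by
    rw [← Pi.single_smul, ← Pi.single_smul, ← Pi.single_add]
    simp
  have hm := (isRiemannianMetricOn_bergmanMetric hD hμ).smooth
  have hre : ∀ k : Fin n, ContDiffOn ℝ ∞ (fun z : Fin n → ℂ => (z k).re) D := fun k =>
    (reCLM.contDiff.comp (contDiff_apply ℝ ℂ k)).contDiffOn
  have him : ∀ k : Fin n, ContDiffOn ℝ ∞ (fun z : Fin n → ℂ => (z k).im) D := fun k =>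
    (imCLM.contDiff.comp (contDiff_apply ℝ ℂ k)).contDiffOn
  simp only [hs _ ((_ : Fin n → ℂ) _), map_add, LinearMap.add_apply, map_smul,
    LinearMap.smul_apply, smul_eq_mul]
  exact ((hre j).mul (((hre i).mul (hm _ _)).add ((him i).mul (hm _ _)))).add
    ((him j).mul (((hre i).mul (hm _ _)).add ((him i).mul (hm _ _))))

/-- The factor `S` of the Gram matrix of the radial vectors, applied after the differential of the
chart, is the coframe of an orthonormal frame. -/
theorem exists_orthonormal_section (hD : IsBoundedLogConvexCompleteReinhardt D)
    (hμ : IsReinhardtWeight D μ) (f₀ : (torusFoliation hD.isOpen).TransverseFrame) :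
    ∃ s : (Fin n → ℂ) → (torusFoliation hD.isOpen).TransverseFrame,
      (∀ z ∈ puncturedPart D, (s z).pt = z ∧
        s z ∈ (torusFoliation hD.isOpen).orthonormalFrames (bergmanMetric D μ)) ∧
      ContDiffOn ℝ ∞ (fun z => (s z).coframe) (puncturedPart D) := by
  classical
  have hmet := isRiemannianMetricOn_bergmanMetric hD hμ
  have hsub : puncturedPart D ⊆ D := fun z hz => hz.1
  obtain ⟨S, hS, hSQ⟩ := exists_contDiffOn_cholesky (U := puncturedPart D)
    (fun z i j => bergmanMetric D μ z (Pi.single i (z i)) (Pi.single j (z j)))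
    (fun i j => (contDiffOn_bergmanMetric_apply hD hμ i j).mono hsub)
    (fun z hz i j => hmet.symm z hz.1 _ _)
    (fun z hz a ha => by
      rw [← bergmanMetric_radial_eq_sum]
      refine hmet.pos z hz.1 _ fun h0 => ha (funext fun k => ?_)
      have := congrFun h0 k
      simpa [radial, hz.2 k] using this)
  set A : (Fin n → ℂ) → (Fin n → ℂ) →ₗ[ℝ] EuclideanSpace ℝ (Fin n) := fun z =>
    (Matrix.toEuclideanLin (Matrix.of (S z))) ∘ₗ (logModuliDeriv z).toLinearMap with hAdef
  have hAapply : ∀ z v k, A z v k = ∑ j, S z k j * (v j / z j).re := fun z v k => by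
    simp [hAdef, Matrix.toEuclideanLin, Matrix.mulVec, dotProduct]
  have hArad : ∀ z ∈ puncturedPart D, ∀ a k, A z (radial z a) k = ∑ j, S z k j * a j :=
    fun z hz a k => by
      rw [hAapply]
      exact Finset.sum_congr rfl fun j _ => by simp [radial, hz.2 j]
  have hinner : ∀ z ∈ puncturedPart D, ∀ a b, inner ℝ (A z (radial z a)) (A z (radial z b))
      = bergmanMetric D μ z (radial z a) (radial z b) := by
    intro z hz a b
    rw [bergmanMetric_radial_eq_sum, PiLp.inner_apply]
    have h : ∀ k, inner ℝ (A z (radial z a) k) (A z (radial z b) k)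
        = ∑ i, ∑ j, a i * b j * (S z k i * S z k j) := fun k => by
      rw [hArad z hz, hArad z hz, RCLike.inner_apply, conj_trivial, mul_comm, Finset.sum_mul_sum]
      exact Finset.sum_congr rfl fun i _ => Finset.sum_congr rfl fun j _ => by ring
    simp only [h, ← hSQ z hz]
    rw [Finset.sum_comm]
    refine Finset.sum_congr rfl fun i _ => ?_
    rw [Finset.sum_comm]
    exact Finset.sum_congr rfl fun j _ => (Finset.mul_sum _ _ _).symm
  have hker : ∀ z ∈ puncturedPart D, (torusFoliation hD.isOpen).tangent z = (A z).ker := by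
    intro z hz
    ext v
    rw [mem_tangent_torusFoliation hD.isOpen hz, LinearMap.mem_ker]
    constructor
    · intro h
      ext k
      simp [hAapply, h]
    · intro h
      have hrad : A z (radial z (logModuliDeriv z v)) = 0 := by
        rw [← h]
        ext k
        rw [hArad z hz, hAapply]
        simp
      have h0 := hinner z hz (logModuliDeriv z v) (logModuliDeriv z v)
      rw [hrad, inner_zero_left] at h0
      have hr : radial z (logModuliDeriv z v) = 0 := by
        by_contra hne
        exact (hmet.pos z hz.1 _ hne).ne h0
      intro k
      have := congrFun hr k
      simpa [radial, hz.2 k] using this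
  have hsurj : ∀ z ∈ puncturedPart D, Function.Surjective (A z) := by
    intro z hz
    have hinj : Function.Injective (Matrix.toEuclideanLin (Matrix.of (S z))) := by
      rw [← LinearMap.ker_eq_bot, LinearMap.ker_eq_bot']
      intro a ha
      have h1 : A z (radial z a) = 0 := by
        simp only [hAdef, LinearMap.comp_apply]
        exact (congrArg _ (logModuliDeriv_radial hz.2 a)).trans ha
      have h2 : radial z a ∈ (torusFoliation hD.isOpen).tangent z := by
        rw [hker z hz]; exact h1
      rw [tangent_torusFoliation hD.isOpen hz] at h2
      exact (logModuliDeriv_radial hz.2 a).symm.trans h2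
    intro b
    obtain ⟨a, rfl⟩ := LinearMap.injective_iff_surjective.1 hinj b
    exact ⟨radial z a, congrArg (Matrix.toEuclideanLin (Matrix.of (S z)))
      (logModuliDeriv_radial hz.2 a)⟩
  refine ⟨fun z => if hz : z ∈ puncturedPart D then
    frameOfCoframe _ z hz (A z) (hker z hz) (hsurj z hz) else f₀, fun z hz => ?_, ?_⟩
  · simp only [dif_pos hz]
    refine ⟨rfl, (mem_orthonormalFrames_iff hD hμ _).2 fun a b => ?_⟩
    exact hinner z hz a b
  · rw [contDiffOn_clm_apply]
    intro v
    have hA : ContDiffOn ℝ ∞ (fun z => A z v) (puncturedPart D) := by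
      rw [contDiffOn_euclidean]
      intro k
      simp only [hAapply]
      refine ContDiffOn.sum fun j _ => (hS k j).mul ?_
      simp only [div_eq_mul_inv]
      exact reCLM.contDiff.comp_contDiffOn (contDiffOn_const.mul
        ((contDiff_apply ℝ ℂ j).contDiffOn.inv fun z hz => hz.2 j))
    refine hA.congr fun z hz => ?_
    simp only [dif_pos hz]
    rfl

theorem isReduction_orthonormalFrames (hD : IsBoundedLogConvexCompleteReinhardt D)
    (hμ : IsReinhardtWeight D μ) :
    (torusFoliation hD.isOpen).IsReduction (orthogonalSubgroup n)
      ((torusFoliation hD.isOpen).orthonormalFrames (bergmanMetric D μ)) where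
  invariant f hf g hg v w hv hw := by
    have hg' : ∀ x, ‖g x‖ = ‖x‖ := hg
    refine Eq.trans ?_ (hf v w hv hw)
    let G : EuclideanSpace ℝ (Fin n) →ₗᵢ[ℝ] EuclideanSpace ℝ (Fin n) := ⟨g.toLinearMap, hg'⟩
    rw [← G.inner_map_map]
    change inner ℝ (g (g.symm _)) (g (g.symm _)) = _
    rw [LinearEquiv.apply_symm_apply, LinearEquiv.apply_symm_apply]
    rfl
  transitive f hf f' hf' hpt := by
    have hn := norm_sq_frame_symm hD hμ hf
    have hn' := norm_sq_frame_symm hD hμ hf'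
    obtain ⟨z, φ, hz⟩ := f
    obtain ⟨z', φ', hz'⟩ := f'
    obtain rfl : z = z' := hpt
    refine ⟨φ'.trans φ.symm, fun a => ?_, ?_⟩
    · obtain ⟨v, hv⟩ := Submodule.mkQ_surjective _ (φ' a)
      have h1 := hn v
      have h2 := hn' v
      simp only [hv, LinearEquiv.symm_apply_apply] at h1 h2
      exact (pow_left_inj₀ (norm_nonneg _) (norm_nonneg _) two_ne_zero).1 (h1.trans h2.symm)
    · refine Foliation.TransverseFrame.ext rfl (heq_of_eq ?_)
      ext a
      simp [Foliation.TransverseFrame.act]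
  section_near x hx := by
    have hker := tangent_torusFoliation hD.isOpen hx
    obtain ⟨s, hs, hsm⟩ := exists_orthonormal_section hD hμ
      (frameOfCoframe _ x hx _ hker fun a => ⟨radial x a, logModuliDeriv_radial hx.2 a⟩)
    exact ⟨_, isOpen_puncturedPart hD.isOpen, hx, s, hs, hsm⟩

end Transverse

/-! ### Foliate fields and equidistance -/

section BundleLike

open Complex Topology

variable {n : ℕ} {D : Set (Fin n → ℂ)} {μ : (Fin n → ℝ) → ℝ}

/-- The generator of the one-parameter group `t ↦ torusAct (t θ)` of the torus. -/
noncomputable def angularCLM (θ : Fin n → ℝ) : (Fin n → ℂ) →L[ℝ] (Fin n → ℂ) :=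
  ContinuousLinearMap.pi fun k =>
    (((θ k * I : ℂ) • ContinuousLinearMap.proj k : (Fin n → ℂ) →L[ℂ] ℂ)).restrictScalars ℝ

@[simp]
theorem angularCLM_apply (θ : Fin n → ℝ) (z : Fin n → ℂ) (k : Fin n) :
    angularCLM θ z k = θ k * I * z k := rfl

theorem isTangentField_angularCLM (hD : IsOpen D) (θ : Fin n → ℝ) :
    (torusFoliation hD).IsTangentField (angularCLM θ) := by
  refine ⟨(angularCLM θ).contDiff.contDiffOn, fun z hz => ?_⟩
  rw [mem_tangent_torusFoliation hD hz]
  intro k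
  rw [angularCLM_apply, mul_div_cancel_right₀ _ (hz.2 k)]
  simp

theorem hasDerivAt_torusAct_smul (θ : Fin n → ℝ) (z : Fin n → ℂ) (t : ℝ) :
    HasDerivAt (fun t : ℝ => torusAct (t • θ) z) (angularCLM θ (torusAct (t • θ) z)) t := by
  rw [hasDerivAt_pi]
  intro k
  have h1 : HasDerivAt (fun t : ℝ => ((t * θ k : ℝ) : ℂ) * I) (θ k * I) t := by
    have := (((hasDerivAt_id t).mul_const (θ k)).ofReal_comp).mul_const I
    simpa using this
  have h2 := h1.cexp.mul_const (z k)
  simp only [torusAct, angularCLM_apply, Pi.smul_apply, smul_eq_mul]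
  convert! h2 using 1
  ring

/-- The components `Re (X_k / z_k)` of a foliate field are constant along the torus orbits: their
derivative along an angular field `Y` is `-Re ([X, Y]_k / z_k)`. -/
theorem logModuliDeriv_foliate (hD : IsBoundedLogConvexCompleteReinhardt D)
    {X : (Fin n → ℂ) → (Fin n → ℂ)} (hX : (torusFoliation hD.isOpen).IsFoliate X) {z : Fin n → ℂ}
    (hz : z ∈ puncturedPart D) (θ : Fin n → ℝ) :
    logModuliDeriv (torusAct θ z) (X (torusAct θ z)) = logModuliDeriv z (X z) := by
  ext k
  rw [logModuliDeriv_apply, logModuliDeriv_apply]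
  set γ : ℝ → Fin n → ℂ := fun t => torusAct (t • θ) z with hγ
  have hγM : ∀ t, γ t ∈ puncturedPart D := fun t =>
    mem_puncturedPart_of_moduli_eq hD (moduli_torusAct _ z) hz
  have hder : ∀ t, HasDerivAt (fun t => (X (γ t) k / γ t k).re) 0 t := by
    intro t
    have hγd := hasDerivAt_torusAct_smul θ z t
    have hXd : HasFDerivAt X (fderiv ℝ X (γ t)) (γ t) :=
      ((hX.1.contDiffAt ((isOpen_puncturedPart hD.isOpen).mem_nhds (hγM t))).differentiableAt
        (by simp)).hasFDerivAt
    have h1 := hasDerivAt_pi.1 (hXd.comp_hasDerivAt t hγd) k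
    have h2 := hasDerivAt_pi.1 hγd k
    have h3 := h1.fun_div h2 ((hγM t).2 k)
    have h4 := reCLM.hasFDerivAt.comp_hasDerivAt t h3
    have hbr := (mem_tangent_torusFoliation hD.isOpen (hγM t) _).1
      (hX.2 _ (isTangentField_angularCLM hD.isOpen θ) (γ t) (hγM t)) k
    rw [VectorField.lieBracket, (angularCLM θ).fderiv] at hbr
    refine h4.congr_deriv ?_
    rw [reCLM_apply]
    have hne := (hγM t).2 k
    have e : (fderiv ℝ X (γ t) (angularCLM θ (γ t)) k * γ t k
        - X (γ t) k * angularCLM θ (γ t) k) / γ t k ^ 2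
        = -((angularCLM θ (X (γ t)) - fderiv ℝ X (γ t) (angularCLM θ (γ t))) k / γ t k) := by
      rw [Pi.sub_apply, angularCLM_apply, angularCLM_apply]
      field_simp
      ring
    refine (congrArg Complex.re e).trans ?_
    rw [neg_re, hbr, neg_zero]
  have hconst := is_const_of_deriv_eq_zero (fun t => (hder t).differentiableAt)
    (fun t => (hder t).deriv) 1 0
  have e0 : γ 0 = z := by simp [hγ]
  have e1 : γ 1 = torusAct θ z := by simp [hγ]
  simpa only [e0, e1] using hconst

theorem isBundleLike_bergmanMetric (hD : IsBoundedLogConvexCompleteReinhardt D)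
    (hμ : IsReinhardtWeight D μ) :
    (torusFoliation hD.isOpen).IsBundleLike (bergmanMetric D μ) := by
  intro X Y hX hY hXp hYp L hL x hx y hy
  rw [leaves_torusFoliation hD] at hL
  obtain ⟨z, hz, rfl⟩ := hL
  rw [mem_torusOrbit_iff] at hx hy
  have hxM := mem_puncturedPart_of_moduli_eq hD hx hz
  have hyM := mem_puncturedPart_of_moduli_eq hD hy hz
  obtain ⟨θ, rfl⟩ := torus_transitive (hy.trans hx.symm)
  rw [(perp_torusFoliation_iff hD hμ hxM _).1 (hXp x hxM),
    (perp_torusFoliation_iff hD hμ hxM _).1 (hYp x hxM),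
    (perp_torusFoliation_iff hD hμ hyM _).1 (hXp _ hyM),
    (perp_torusFoliation_iff hD hμ hyM _).1 (hYp _ hyM), logModuliDeriv_foliate hD hX hxM,
    logModuliDeriv_foliate hD hY hxM, bergmanMetric_radial_torusAct hD hμ hxM.1]

theorem riemannianDist_torusAct_le (hD : IsBoundedLogConvexCompleteReinhardt D)
    (hμ : IsReinhardtWeight D μ) {M : Set (Fin n → ℂ)} (hMD : M ⊆ D)
    (hM : ∀ θ, ∀ z ∈ M, torusAct θ z ∈ M) (θ : Fin n → ℝ) (p q : Fin n → ℂ) :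
    riemannianDist M (bergmanMetric D μ) (torusAct θ p) (torusAct θ q)
      ≤ riemannianDist M (bergmanMetric D μ) p q := by
  refine le_iInf fun γ => le_iInf fun hγ => le_iInf fun hγM => le_iInf fun h0 =>
    le_iInf fun h1 => ?_
  refine iInf_le_of_le (fun t => torusAct θ (γ t)) (iInf_le_of_le ?_ (iInf_le_of_le ?_
    (iInf_le_of_le (congrArg (torusAct θ) h0) (iInf_le_of_le (congrArg (torusAct θ) h1) ?_))))
  · exact (torusCLM θ).contDiff.comp_contDiffOn hγ
  · exact fun t ht => hM θ _ (hγM ht)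
  · refine le_of_eq (MeasureTheory.setLIntegral_congr_fun measurableSet_Icc fun t ht => ?_)
    have hd : HasDerivWithinAt γ (derivWithin γ (Set.Icc 0 1) t) (Set.Icc 0 1) t :=
      (hγ.differentiableOn (by simp) t ht).hasDerivWithinAt
    have hTd : derivWithin (fun t => torusAct θ (γ t)) (Set.Icc 0 1) t
        = torusAct θ (derivWithin γ (Set.Icc 0 1) t) :=
      ((torusCLM θ).hasFDerivAt.comp_hasDerivWithinAt t hd).derivWithin
        (uniqueDiffOn_Icc zero_lt_one t ht)
    simp only [hTd, bergmanMetric_torusAct hD hμ θ (hMD (hγM ht))]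

theorem equidistant_torusOrbits (hD : IsBoundedLogConvexCompleteReinhardt D)
    (hμ : IsReinhardtWeight D μ) {M : Set (Fin n → ℂ)} (hMD : M ⊆ D)
    (hM : ∀ θ, ∀ z ∈ M, torusAct θ z ∈ M) :
    Equidistant M (bergmanMetric D μ) (torusOrbit '' puncturedPart D) := by
  have hle : ∀ (z p : Fin n → ℂ) (θ : Fin n → ℝ),
      ⨅ y ∈ torusOrbit z, riemannianDist M (bergmanMetric D μ) (torusAct θ p) y
        ≤ ⨅ y ∈ torusOrbit z, riemannianDist M (bergmanMetric D μ) p y := by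
    intro z p θ
    refine le_iInf₂ fun y hy => iInf₂_le_of_le (torusAct θ y) ?_
      (riemannianDist_torusAct_le hD hμ hMD hM θ p y)
    rw [mem_torusOrbit_iff] at hy ⊢
    rw [moduli_torusAct, hy]
  rintro _ ⟨w, -, rfl⟩ _ ⟨z, -, rfl⟩ p hp p' hp'
  rw [mem_torusOrbit_iff] at hp hp'
  obtain ⟨θ, rfl⟩ := torus_transitive (hp'.trans hp.symm)
  refine le_antisymm ?_ (hle z p θ)
  simpa using hle z (torusAct θ p) (-θ)

end BundleLike

theorem mainTheorem5 (n : ℕ) (D : Set (Fin n → ℂ)) (hD : IsBoundedLogConvexCompleteReinhardt D)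
    (μ : (Fin n → ℝ) → ℝ) (hμ : IsReinhardtWeight D μ) :
    IsOpen (puncturedPart D) ∧
    MeasureTheory.volume (D \ puncturedPart D) = 0 ∧
    IsRiemannianMetricOn D (bergmanMetric D μ) ∧
    ∃ 𝓞 : RiemannianFoliation (puncturedPart D) n,
      𝓞.leaves = torusOrbit '' puncturedPart D ∧
      𝓞.IsCompatibleBundleLike (bergmanMetric D μ) ∧
      Equidistant (puncturedPart D) (bergmanMetric D μ) 𝓞.leaves ∧
      Equidistant D (bergmanMetric D μ) 𝓞.leaves := by
  have hmet := isRiemannianMetricOn_bergmanMetric hD hμ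
  have hsub : puncturedPart D ⊆ D := fun z hz => hz.1
  refine ⟨isOpen_puncturedPart hD.isOpen, volume_diff_puncturedPart D, hmet,
    ⟨torusFoliation hD.isOpen, (torusFoliation hD.isOpen).orthonormalFrames (bergmanMetric D μ),
      isReduction_orthonormalFrames hD hμ, isSaturated_orthonormalFrames hD hμ⟩,
    leaves_torusFoliation hD, ⟨⟨fun u v => (hmet.smooth u v).mono hsub,
      fun x hx => hmet.symm x hx.1, fun x hx => hmet.pos x hx.1⟩,
      isBundleLike_bergmanMetric hD hμ, rfl⟩, ?_, ?_⟩
  · rw [leaves_torusFoliation hD]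
    exact equidistant_torusOrbits hD hμ hsub fun θ z hz =>
      mem_puncturedPart_of_moduli_eq hD (moduli_torusAct θ z) hz
  · rw [leaves_torusFoliation hD]
    exact equidistant_torusOrbits hD hμ subset_rfl fun θ z hz =>
      (hD.mem_iff_of_moduli_eq (moduli_torusAct θ z)).2 hz
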